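/- Let $F$ be a field with four elements and $w\in F$ with $w^2=w+1$. An $[n,k,d]$ code is a $k$-dimensional subspace of $F^n$ with minimum Hamming distance exactly $d$. A code $C$ is an $(r,\delta)$-LRC code if every coordinate $i$ lies in a set $R$ of at most $r+\delta-1$ coordinates such that the restriction $C|_R$ has minimum distance at least $\delta$. An $[n,k,d]$ code with $d\ge\delta>2$ and $k>r\ge1$ is an *optimal $(r,\delta)$-LRC code* if it is an $(r,\delta)$-LRC code, it is not an $(r',\delta)$-LRC code for any $r'<r$, and $d=n-k+1-(\lceil k/r\rceil-1)(\delta-1)$. Below, "optimal" means optimal $(3,4)$-LRC code over $F$. Then: 1. There is no optimal $[11,4,5]$ code. 2. For $d\ge5$ and any $n$, an optimal $[n,4,d]$ code exists if and only if $n=d+6$ and $6\le d\le12$. For $d\ge13$ there is no linear $[d+6,4,d]$ code over $F$ at all. 3. The code generated by the rows of $$G=\left(\begin{array}{cccccc|cccccc|cccccc} 0&0&0&0&0&0&1&w&1&w&1&w&w^2&1&w^2&1&w^2&1\\ 1&0&0&1&1&1&1&0&0&1&1&1&1&0&0&1&1&1\\ 0&1&0&1&w^2&w&0&1&0&1&w^2&w&0&1&0&1&w^2&w\\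 0&0&1&1&w&w^2&0&0&1&1&w&w^2&0&0&1&1&w&w^2\end{array}\right)$$ is an optimal $[18,4,12]$ code. Deleting the coordinates in $S=\{18\}$, $\{10,13\}$, $\{10,13,18\}$, $\{9,10,13,18\}$, $\{10,13,14,16,18\}$, $\{8,10,11,13,15,18\}$ gives optimal $[d+6,4,d]$ codes with $d=11,10,9,8,7,6$ respectively. 4. Every optimal $[n,k,d]$ code with $d\ge5$ has $k=3s+1$ and $n=6s+d$ for some $s\ge1$. If $s\ge2$, then $n=6l$ for some $l$, and either $d=6$, $l=s+1$, $k=3l-2$ with $l\ge3$, or $d=12$, $l=s+2$, $k=3l-5$ with $4\le l\le20$. In particular there is no optimal code with $d=12$, $l=21$, i.e. no optimal $[126,58,12]$ code. 5. Let $$\tilde H=\begin{pmatrix}1&0&0&1&1&1\\0&1&0&1&w&w^2\\0&0&1&1&w^2&w\end{pmatrix},\qquad B=\begin{pmatrix}0&0&0&1&0&w^2\\0&0&0&0&1&w^2\end{pmatrix}.$$ For every $l\ge3$ the code with parity-check matrix $\begin{pmatrix}I_l\otimes\tilde H\\ B\ B\ \cdots\ B\end{pmatrix}$ is an optimal $[6l,3l-2,6]$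 code. 6. For $1\le i\le17$ let $A_i=(\mathbf 0\ \mathbf 0\ \mathbf 0\ \mathbf u_i\ \mathbf v_i\ \mathbf z_i)$ be the $5\times6$ matrix with the following columns (vectors in $F^5$ written as rows): $$\begin{array}{c|ccc} i&\mathbf u_i&\mathbf v_i&\mathbf z_i\\\hline 1&(w^2,0,w,0,0)&(0,w^2,w^2,0,0)&(w^2,w^2,0,0,0)\\ 2&(w^2,0,0,w^2,w)&(0,0,0,w^2,1)&(w^2,0,0,0,1)\\ 3&(0,1,w,1,w)&(1,0,1,0,1)&(0,w^2,w,w^2,w)\\ 4&(0,1,w,w,w^2)&(1,0,1,0,w)&(w^2,1,0,w,0)\\ 5&(0,1,w,w^2,1)&(1,0,1,0,w^2)&(w,1,1,w^2,w^2)\\ 6&(1,1,1,0,w)&(1,w,1,w^2,w^2)&(1,1,w,w^2,w)\\ 7&(1,1,1,1,w^2)&(1,w,1,1,w)&(1,1,w,w,0)\\ 8&(1,1,1,w,0)&(1,w,w^2,w,w)&(w^2,w,1,0,1)\\ 9&(1,1,1,w^2,1)&(1,w,w^2,0,1)&(w,1,w^2,1,0)\\ 10&(1,1,1,0,w^2)&(1,1,w^2,w^2,w^2)&(w^2,w,w^2,w,1)\\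 11&(1,1,1,1,w)&(1,w^2,1,0,w^2)&(1,1,w^2,w,0)\\ 12&(1,1,1,w,1)&(1,w,1,w,w^2)&(w,w,w^2,1,0)\\ 13&(1,1,1,w^2,0)&(1,1,w,w,w)&(1,w,1,0,w)\\ 14&(1,1,1,0,1)&(1,w,w^2,w^2,w)&(w^2,w,1,w,w)\\ 15&(1,1,1,1,0)&(1,w,w^2,1,1)&(w,1,w^2,0,w)\\ 16&(1,1,1,w,w^2)&(1,1,w^2,w^2,0)&(w^2,w,w^2,0,w^2)\\ 17&(1,1,1,w^2,w)&(1,w,w^2,w,0)&(w,1,w^2,w,w^2) \end{array}$$ For every $T=\{i_1,\dots,i_l\}\subseteq\{1,\dots,17\}$ with $l\ge4$ elements, the code with parity-check matrix $\begin{pmatrix}I_l\otimes\tilde H\\ A_{i_1}\ \cdots\ A_{i_l}\end{pmatrix}$ is an optimal $[6l,3l-5,12]$ code. Thus optimal codes with $d=12$ exist for all $4\le l\le17$. -/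

import Mathlib

open scoped Kronecker

/-- A linear code `C ⊆ F^ι` in which any two distinct codewords have Hamming distance at least `d`
(for the zero code this holds for every `d`). -/
def MinDistGE {F ι : Type*} [Field F] [DecidableEq F] [Fintype ι]
    (C : Submodule F (ι → F)) (d : ℕ) : Prop :=
  ∀ a ∈ C, ∀ b ∈ C, a ≠ b → d ≤ hammingDist a b

/-- `C` is an `[n, k, d]` linear code: length `n`, dimension `k`, minimum Hamming distance exactly
`d` (attained by some pair of distinct codewords). -/
structure IsLinearCode {F ι : Type*} [Field F] [DecidableEq F] [Fintype ι]
    (C : Submodule F (ι → F)) (n k d : ℕ) : Prop where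
  length_eq : Fintype.card ι = n
  dim_eq : Module.finrank F C = k
  minDist_ge : MinDistGE C d
  minDist_attained : ∃ a ∈ C, ∃ b ∈ C, a ≠ b ∧ hammingDist a b = d

/-- The restriction `C|_R` of a code to the coordinates in `R`. -/
def restrictCode {F ι : Type*} [Field F]
    (C : Submodule F (ι → F)) (R : Finset ι) : Submodule F ({i // i ∈ R} → F) :=
  C.map (LinearMap.funLeft F F (Subtype.val : {i // i ∈ R} → ι))

/-- The code obtained by puncturing `C` on `S`, i.e. by deleting the coordinates in `S`. -/
def punctureCode {F ι : Type*} [Field F] [Fintype ι] [DecidableEq ι]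
    (C : Submodule F (ι → F)) (S : Finset ι) : Submodule F ({i // i ∈ Sᶜ} → F) :=
  restrictCode C Sᶜ

/-- `C` is an `(r, δ)`-LRC code: every coordinate `i` lies in a set `R` of at most `r + δ - 1`
coordinates such that `C|_R` has minimum distance at least `δ`. -/
def IsLRC {F ι : Type*} [Field F] [DecidableEq F]
    (C : Submodule F (ι → F)) (r δ : ℕ) : Prop :=
  ∀ i : ι, ∃ R : Finset ι, i ∈ R ∧ R.card + 1 ≤ r + δ ∧ MinDistGE (restrictCode C R) δ

/-- `C` is an optimal `(r, δ)`-LRC code with parameters `[n, k, d]`: it is `r`-optimal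
(`r` cannot be decreased) and `d`-optimal (equality in the Singleton-like bound), with
`d ≥ δ > 2` and `k > r ≥ 1`. -/
structure IsOptimalLRC {F ι : Type*} [Field F] [DecidableEq F] [Fintype ι]
    (C : Submodule F (ι → F)) (n k d r δ : ℕ) : Prop where
  isLinearCode : IsLinearCode C n k d
  isLRC : IsLRC C r δ
  r_optimal : ∀ r' < r, ¬ IsLRC C r' δ
  d_optimal : (d : ℤ) = n - k + 1 - (⌈(k : ℚ) / (r : ℚ)⌉ - 1) * ((δ : ℤ) - 1)
  delta_gt : 2 < δ
  delta_le : δ ≤ d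
  r_pos : 1 ≤ r
  r_lt : r < k

/-- The code generated by the rows of `G`. -/
def codeOfGenerator {F κ ι : Type*} [Field F] (G : Matrix κ ι F) : Submodule F (ι → F) :=
  Submodule.span F (Set.range G.row)

/-- The code with parity-check matrix `H`. -/
def codeOfParityCheck {F κ ι : Type*} [Field F] [Fintype ι] (H : Matrix κ ι F) :
    Submodule F (ι → F) :=
  LinearMap.ker H.mulVecLin

/-- The generator matrix of a `[18, 4, 12]` code; `w` is a primitive element of the field of
order four. Columns are numbered from `0`. -/
def genMatrix18 {F : Type*} [Field F] (w : F) : Matrix (Fin 4) (Fin 18) F :=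
  !![0, 0, 0, 0, 0, 0, 1, w, 1, w, 1, w, w^2, 1, w^2, 1, w^2, 1;
     1, 0, 0, 1, 1, 1, 1, 0, 0, 1, 1, 1, 1, 0, 0, 1, 1, 1;
     0, 1, 0, 1, w^2, w, 0, 1, 0, 1, w^2, w, 0, 1, 0, 1, w^2, w;
     0, 0, 1, 1, w, w^2, 0, 0, 1, 1, w, w^2, 0, 0, 1, 1, w, w^2]

/-- The generator matrix of the `[6, 3, 4]` hexacode. -/
def hexacodeMatrix {F : Type*} [Field F] (w : F) : Matrix (Fin 3) (Fin 6) F :=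
  !![1, 0, 0, 1, 1, 1;
     0, 1, 0, 1, w, w^2;
     0, 0, 1, 1, w^2, w]

/-- The parity-check matrix whose upper part is `I ⊗ hexacodeMatrix` (one local group for each
`i : κ`) and whose lower part (the global group) is made of the blocks `A i`. -/
def localGroupsMatrix {F κ : Type*} [Field F] [DecidableEq κ] {m : ℕ} (w : F)
    (A : κ → Matrix (Fin m) (Fin 6) F) : Matrix ((κ × Fin 3) ⊕ Fin m) (κ × Fin 6) F :=
  Matrix.fromRows ((1 : Matrix κ κ F) ⊗ₖ hexacodeMatrix w) (Matrix.of fun a p => A p.1 a p.2)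

/-- The block of the global group used for minimum distance six. -/
def globalBlock6 {F : Type*} [Field F] (w : F) : Matrix (Fin 2) (Fin 6) F :=
  !![0, 0, 0, 1, 0, w^2;
     0, 0, 0, 0, 1, w^2]

/-- The vectors `u_i, v_i, z_i ∈ F^5`, `i = 1, …, 17`. -/
def uvz {F : Type*} [Field F] (w : F) : Fin 17 → Fin 3 → Fin 5 → F :=
  ![
    ![![w^2, 0, w, 0, 0], ![0, w^2, w^2, 0, 0], ![w^2, w^2, 0, 0, 0]],
    ![![w^2, 0, 0, w^2, w], ![0, 0, 0, w^2, 1], ![w^2, 0, 0, 0, 1]],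
    ![![0, 1, w, 1, w], ![1, 0, 1, 0, 1], ![0, w^2, w, w^2, w]],
    ![![0, 1, w, w, w^2], ![1, 0, 1, 0, w], ![w^2, 1, 0, w, 0]],
    ![![0, 1, w, w^2, 1], ![1, 0, 1, 0, w^2], ![w, 1, 1, w^2, w^2]],
    ![![1, 1, 1, 0, w], ![1, w, 1, w^2, w^2], ![1, 1, w, w^2, w]],
    ![![1, 1, 1, 1, w^2], ![1, w, 1, 1, w], ![1, 1, w, w, 0]],
    ![![1, 1, 1, w, 0], ![1, w, w^2, w, w], ![w^2, w, 1, 0, 1]],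
    ![![1, 1, 1, w^2, 1], ![1, w, w^2, 0, 1], ![w, 1, w^2, 1, 0]],
    ![![1, 1, 1, 0, w^2], ![1, 1, w^2, w^2, w^2], ![w^2, w, w^2, w, 1]],
    ![![1, 1, 1, 1, w], ![1, w^2, 1, 0, w^2], ![1, 1, w^2, w, 0]],
    ![![1, 1, 1, w, 1], ![1, w, 1, w, w^2], ![w, w, w^2, 1, 0]],
    ![![1, 1, 1, w^2, 0], ![1, 1, w, w, w], ![1, w, 1, 0, w]],
    ![![1, 1, 1, 0, 1], ![1, w, w^2, w^2, w], ![w^2, w, 1, w, w]],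
    ![![1, 1, 1, 1, 0], ![1, w, w^2, 1, 1], ![w, 1, w^2, 0, w]],
    ![![1, 1, 1, w, w^2], ![1, 1, w^2, w^2, 0], ![w^2, w, w^2, 0, w^2]],
    ![![1, 1, 1, w^2, w], ![1, w, w^2, w, 0], ![w, 1, w^2, w, w^2]]
  ]

/-- The `5 × 6` block with columns `0, 0, 0, u_i, v_i, z_i`. -/
def globalBlock12 {F : Type*} [Field F] (w : F) (i : Fin 17) : Matrix (Fin 5) (Fin 6) F :=
  Matrix.of fun a => ![0, 0, 0, uvz w i 0 a, uvz w i 1 a, uvz w i 2 a]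

/-!
All bounds come from one dimension count. For a set `S` of coordinates let `z(S)` be the dimension of
the subcode of words vanishing on `S` (`vanishingOn`). A repair group that is not determined by `S`
adds at least four coordinates and raises `|S| + z(S)` by at least three while `z(S)` drops by at most
three (`exists_step`); iterating this gives the Singleton-like bound. If the bound is attained and
`d ≥ 5`, every slack is excluded by the Plotkin bound for two-dimensional quaternary codes
(`five_mul_le_of_two_le_finrank`): first `k = 3 s + 1` and `n = 6 s + d` (`exists_isTight`), then
every repair group has six coordinates and carries a `[6, 3, 4]` code (`IsTight.finrank_group`), and
for `s ≥ 2` the repair groups are disjoint (`IsTight.disjoint_groups`), so `6` divides `n` and `d`.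

Conversely, a code of length `6 s + d`, dimension at least `3 s + 1`, minimum distance at least
`d ≥ 5` and locality `(3, 4)` is automatically optimal (`isTight_of_le`, `IsTight.isOptimalLRC`): the
same count bounds the dimension, shows that `d` is attained, and forces all repair groups to have
size six. So the explicit codes only need a lower bound on weights and repair groups.

For `d ≤ 12`, shorten at `s - 1` repair groups to a four-dimensional code whose length exceeds `d` by
at most six. If `d ≥ 13`, its coordinates are points of the three-dimensional projective space over
the field with four elements, no three of them collinear by the Plotkin bound, and there are more than
`17` of them. Such a cap does not exist (`IsCap.card_le`). Suppose that a cap has at least `18` points.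
A tangent line lies on a plane with five points, all of whose tangents in that plane pass through
a nucleus `N`; a secant through `N` would lie on planes with at most five points only, which leaves
room for `17` points. So `N` can be added to the cap, and a largest cap has no tangents. But then it
has `22` points, and its plane sections have `0` or `6` points, contradicting the count of points on
the planes through a line that misses the cap.

There is no optimal code with parameters `[11, 4, 5]` because a `[6, 3, 4]` code has no words of weight
five (`IsTight.not_one_five`). For `d = 12` there are at most twenty repair groups
(`IsTight.card_partition_le`): the words that agree on each group with a codeword lie in at most
`4 ^ 5` classes modulo the code, and the words supported on a single group fill too many of these
classes.

For the explicit codes of dimension four the weights of all `256` words are computed. For the codes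
given by local groups, a word with three nonzero blocks has weight at least twelve, so that only the
kernel of a single block and coincidences between two blocks matter (`le_hammingNorm_localGroups`);
for the seventeen blocks these are decided by comparing syndromes.
-/

namespace LRCode

/-! ### Vanishing subcodes and the Plotkin bound -/

section Basic

variable {F ι : Type*} [Field F]

/-- The subcode of the words of `C` that vanish on `S`. Its dimension is `dim C - rank S`, where
`rank S` is the dimension of the restriction of `C` to `S`. -/
def vanishingOn (C : Submodule F (ι → F)) (S : Finset ι) : Submodule F (ι → F) :=
  C ⊓ ⨅ i ∈ S, LinearMap.ker (LinearMap.proj i : (ι → F) →ₗ[F] F)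

theorem mem_vanishingOn {C : Submodule F (ι → F)} {S : Finset ι} {x : ι → F} :
    x ∈ vanishingOn C S ↔ x ∈ C ∧ ∀ i ∈ S, x i = 0 := by
  simp [vanishingOn]

theorem vanishingOn_le (C : Submodule F (ι → F)) (S : Finset ι) : vanishingOn C S ≤ C :=
  inf_le_left

theorem vanishingOn_empty (C : Submodule F (ι → F)) : vanishingOn C ∅ = C := by
  simp [vanishingOn]

theorem vanishingOn_anti (C : Submodule F (ι → F)) {S T : Finset ι} (h : S ⊆ T) :
    vanishingOn C T ≤ vanishingOn C S := by
  intro x hx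
  rw [mem_vanishingOn] at hx ⊢
  exact ⟨hx.1, fun i hi => hx.2 i (h hi)⟩

theorem finrank_le_finrank_inf_ker {V : Type*} [AddCommGroup V] [Module F V]
    [FiniteDimensional F V] (W : Submodule F V) (f : V →ₗ[F] F) :
    Module.finrank F W ≤ Module.finrank F (W ⊓ LinearMap.ker f : Submodule F V) + 1 := by
  have h1 := LinearMap.finrank_range_add_finrank_ker (f.domRestrict W)
  have h2 : Module.finrank F (LinearMap.range (f.domRestrict W)) ≤ 1 := by
    simpa using Submodule.finrank_le (LinearMap.range (f.domRestrict W))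
  have h3 : (LinearMap.ker (f.domRestrict W)).map W.subtype = W ⊓ LinearMap.ker f := by
    ext x
    simp only [Submodule.mem_map, LinearMap.mem_ker, Submodule.mem_inf]
    constructor
    · rintro ⟨y, hy, rfl⟩
      exact ⟨y.2, hy⟩
    · rintro ⟨hx, hf⟩
      exact ⟨⟨x, hx⟩, hf, rfl⟩
  rw [← h3, Submodule.finrank_map_subtype_eq]
  omega

theorem exists_submodule_finrank_eq {V : Type*} [AddCommGroup V] [Module F V]
    [FiniteDimensional F V] {U W : Submodule F V} (hUW : U ≤ W) {m : ℕ}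
    (hU : Module.finrank F U ≤ m) (hm : m ≤ Module.finrank F W) :
    ∃ X : Submodule F V, U ≤ X ∧ X ≤ W ∧ Module.finrank F X = m := by
  induction m, hU using Nat.le_induction with
  | base => exact ⟨U, le_rfl, hUW, rfl⟩
  | succ m hm' ih =>
    obtain ⟨X, hUX, hXW, hX⟩ := ih (by omega)
    have hlt : X < W := lt_of_le_of_ne hXW fun h => by rw [h] at hX; omega
    obtain ⟨x, hxW, hxX⟩ := SetLike.exists_of_lt hlt
    refine ⟨X ⊔ Submodule.span F {x}, hUX.trans le_sup_left,
      sup_le hXW ((Submodule.span_singleton_le_iff_mem _ _).2 hxW), ?_⟩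
    have h1 := Submodule.finrank_sup_add_finrank_inf_eq X (Submodule.span F {x})
    have h2 : X ⊓ Submodule.span F {x} = ⊥ := by
      rw [← disjoint_iff, Submodule.disjoint_span_singleton]
      exact fun h => absurd h hxX
    have h3 : Module.finrank F (Submodule.span F {x}) = 1 :=
      finrank_span_singleton fun h => hxX (h ▸ X.zero_mem)
    rw [h2, finrank_bot] at h1
    omega

variable [Fintype ι] [DecidableEq ι]

theorem finrank_vanishingOn_insert (C : Submodule F (ι → F)) (S : Finset ι) (i : ι) :
    Module.finrank F (vanishingOn C S) ≤ Module.finrank F (vanishingOn C (insert i S)) + 1 := by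
  have h : vanishingOn C (insert i S) =
      vanishingOn C S ⊓ LinearMap.ker (LinearMap.proj i : (ι → F) →ₗ[F] F) := by
    ext x
    simp only [mem_vanishingOn, Finset.forall_mem_insert, Submodule.mem_inf, LinearMap.mem_ker,
      LinearMap.proj_apply]
    tauto
  rw [h]
  exact finrank_le_finrank_inf_ker _ _

theorem finrank_vanishingOn_union (C : Submodule F (ι → F)) (S T : Finset ι) :
    Module.finrank F (vanishingOn C S) ≤
      Module.finrank F (vanishingOn C (S ∪ T)) + T.card := by
  induction T using Finset.induction_on with
  | empty => rw [Finset.union_empty]; simp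
  | insert i T hi ih =>
    have := finrank_vanishingOn_insert C (S ∪ T) i
    rw [Finset.union_insert, Finset.card_insert_of_notMem hi]
    omega

/-- Adding coordinates one at a time, the dimension of the vanishing subcode can be lowered to any
prescribed value without lowering `|S| + dim`. -/
theorem exists_finrank_vanishingOn_eq (C : Submodule F (ι → F)) {j : ℕ} (S : Finset ι)
    (hj : j ≤ Module.finrank F (vanishingOn C S)) :
    ∃ S' : Finset ι, S ⊆ S' ∧ Module.finrank F (vanishingOn C S') = j ∧
      S.card + Module.finrank F (vanishingOn C S) ≤ S'.card + j := by
  obtain ⟨m, hm⟩ := Nat.exists_eq_add_of_le hj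
  induction m generalizing S with
  | zero => exact ⟨S, subset_rfl, by omega, by omega⟩
  | succ m ih =>
    have hne : vanishingOn C S ≠ ⊥ := by
      intro h
      rw [h, finrank_bot] at hm
      omega
    obtain ⟨x, hx, hx0⟩ := Submodule.exists_mem_ne_zero_of_ne_bot hne
    obtain ⟨i, hi⟩ := Function.ne_iff.mp hx0
    have hiS : i ∉ S := fun h => hi ((mem_vanishingOn.1 hx).2 i h)
    have h1 := finrank_vanishingOn_insert C S i
    have h2 : Module.finrank F (vanishingOn C (insert i S)) <
        Module.finrank F (vanishingOn C S) := by
      apply Submodule.finrank_lt_finrank_of_lt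
      refine lt_of_le_of_ne (vanishingOn_anti C (Finset.subset_insert i S)) fun h => ?_
      rw [← h] at hx
      exact hi ((mem_vanishingOn.1 hx).2 i (Finset.mem_insert_self i S))
    obtain ⟨S', hS', h3, h4⟩ := ih (insert i S) (by omega) (by omega)
    refine ⟨S', (Finset.subset_insert i S).trans hS', h3, ?_⟩
    rw [Finset.card_insert_of_notMem hiS] at h4
    omega

end Basic

section Weights

variable {F ι : Type*} [Field F] [DecidableEq F] [Fintype ι]

theorem minDistGE_iff {C : Submodule F (ι → F)} {d : ℕ} :
    MinDistGE C d ↔ ∀ c ∈ C, c ≠ 0 → d ≤ hammingNorm c := by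
  constructor
  · intro h c hc h0
    simpa [hammingDist_zero_right] using h c hc 0 C.zero_mem h0
  · intro h a ha b hb hab
    rw [hammingDist_eq_hammingNorm]
    exact h _ (C.add_mem (C.neg_mem ha) hb) fun h0 => hab (neg_add_eq_zero.1 h0)

theorem four_mul_card_ne_zero_le [Fintype F] (hF : Fintype.card F = 4)
    (V : Submodule F (ι → F)) [Fintype V] (i : ι) :
    4 * (Finset.univ.filter fun v : V => v.1 i ≠ 0).card ≤ 3 * 4 ^ Module.finrank F V := by
  classical
  let f : V →ₗ[F] F := (LinearMap.proj i).comp V.subtype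
  have h1 := LinearMap.finrank_range_add_finrank_ker f
  have h2 : Module.finrank F (LinearMap.range f) ≤ 1 := by
    simpa using Submodule.finrank_le (LinearMap.range f)
  have hV : Fintype.card V = 4 ^ Module.finrank F V := by
    rw [Module.card_eq_pow_finrank (K := F) (V := V), hF]
  have hK : Fintype.card (LinearMap.ker f) = 4 ^ Module.finrank F (LinearMap.ker f) := by
    rw [Module.card_eq_pow_finrank (K := F) (V := LinearMap.ker f), hF]
  have hK' : Fintype.card (LinearMap.ker f) =
      (Finset.univ.filter fun v : V => v.1 i = 0).card := by
    rw [← Fintype.card_subtype]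
    exact Fintype.card_congr (Equiv.refl _)
  have hsum := Finset.card_filter_add_card_filter_not (s := (Finset.univ : Finset V))
    (fun v : V => v.1 i = 0)
  rw [Finset.card_univ, hV, ← hK', hK] at hsum
  have h3 : 4 ^ Module.finrank F V ≤ 4 * 4 ^ Module.finrank F (LinearMap.ker f) := by
    rw [← pow_succ']
    exact Nat.pow_le_pow_right (by norm_num) (by omega)
  have h4 : (Finset.univ.filter fun v : V => ¬ v.1 i = 0).card =
    (Finset.univ.filter fun v : V => v.1 i ≠ 0).card := rfl
  omega

/-- The averaging argument behind the Plotkin bound: each coordinate is nonzero on at most three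
quarters of the words of a quaternary code. -/
theorem four_mul_sum_hammingNorm_le [Fintype F] (hF : Fintype.card F = 4)
    (V : Submodule F (ι → F)) [Fintype V] (T : Finset ι) (hT : ∀ v ∈ V, ∀ i ∉ T, v i = 0) :
    4 * ∑ v : V, hammingNorm v.1 ≤ 3 * T.card * 4 ^ Module.finrank F V := by
  classical
  have h1 : ∑ v : V, hammingNorm v.1 =
      ∑ i ∈ T, (Finset.univ.filter fun v : V => v.1 i ≠ 0).card := by
    simp only [hammingNorm, Finset.card_filter]
    rw [Finset.sum_comm]
    symm
    apply Finset.sum_subset (Finset.subset_univ T)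
    intro i _ hi
    apply Finset.sum_eq_zero
    intro v _
    simp [hT v.1 v.2 i hi]
  rw [h1, Finset.mul_sum]
  calc _ ≤ ∑ i ∈ T, 3 * 4 ^ Module.finrank F V :=
        Finset.sum_le_sum fun i _ => four_mul_card_ne_zero_le hF V i
    _ = _ := by rw [Finset.sum_const, smul_eq_mul]; ring

/-- The total weight of the fifteen nonzero words of a two-dimensional code supported on `T` is at
most `12 |T|`; the word `x` is singled out to use its own weight instead of the minimum. -/
theorem hammingNorm_add_fourteen_mul_le [Fintype F] (hF : Fintype.card F = 4)
    {V : Submodule F (ι → F)} {T : Finset ι} (hT : ∀ v ∈ V, ∀ i ∉ T, v i = 0)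
    (hV : 2 ≤ Module.finrank F V) {d : ℕ} (hd : ∀ v ∈ V, v ≠ 0 → d ≤ hammingNorm v)
    {x : ι → F} (hx : x ∈ V) (hx0 : x ≠ 0) :
    hammingNorm x + 14 * d ≤ 12 * T.card := by
  classical
  obtain ⟨W, hxW, hWV, hW⟩ := exists_submodule_finrank_eq (F := F)
    (U := Submodule.span F {x}) (W := V) (m := 2)
    ((Submodule.span_singleton_le_iff_mem _ _).2 hx) (by
      rw [finrank_span_singleton hx0]; norm_num) hV
  rw [Submodule.span_singleton_le_iff_mem] at hxW
  have : Fintype W := Fintype.ofFinite W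
  have h1 := four_mul_sum_hammingNorm_le hF W T fun v hv => hT v (hWV hv)
  have hcard : Fintype.card W = 16 := by
    rw [Module.card_eq_pow_finrank (K := F) (V := W), hF, hW]; norm_num
  have h2 : ∑ v ∈ (Finset.univ.erase (⟨x, hxW⟩ : W)).erase 0, d ≤
      ∑ v ∈ (Finset.univ.erase (⟨x, hxW⟩ : W)).erase 0, hammingNorm v.1 := by
    apply Finset.sum_le_sum
    intro v hv
    apply hd v.1 (hWV v.2)
    simpa using (Finset.mem_erase.1 hv).1
  have hmem : (0 : W) ∈ Finset.univ.erase (⟨x, hxW⟩ : W) := by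
    simp [Subtype.ext_iff, Ne.symm hx0]
  rw [Finset.sum_const, Finset.card_erase_of_mem hmem, Finset.card_erase_of_mem (by simp),
    Finset.card_univ, hcard] at h2
  have h3 : hammingNorm x + ∑ v ∈ Finset.univ.erase (⟨x, hxW⟩ : W), hammingNorm v.1 =
      ∑ v : W, hammingNorm v.1 :=
    Finset.add_sum_erase Finset.univ (fun v : W => hammingNorm v.1) (Finset.mem_univ ⟨x, hxW⟩)
  have h4 := Finset.add_sum_erase _ (fun v : W => hammingNorm v.1) hmem
  rw [hW] at h1
  simp only [smul_eq_mul] at h2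
  omega

theorem five_mul_le_of_two_le_finrank [Fintype F] (hF : Fintype.card F = 4)
    {V : Submodule F (ι → F)} {T : Finset ι} (hT : ∀ v ∈ V, ∀ i ∉ T, v i = 0)
    (hV : 2 ≤ Module.finrank F V) {d : ℕ} (hd : ∀ v ∈ V, v ≠ 0 → d ≤ hammingNorm v) :
    5 * d ≤ 4 * T.card := by
  have hne : V ≠ ⊥ := by
    intro h
    rw [h, finrank_bot] at hV
    omega
  obtain ⟨x, hx, hx0⟩ := Submodule.exists_mem_ne_zero_of_ne_bot hne
  have h1 := hammingNorm_add_fourteen_mul_le hF hT hV hd hx hx0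
  have h2 := hd x hx hx0
  omega

end Weights

/-! ### Repair groups and tight codes -/

section RepairGroups

variable {F ι : Type*} [Field F] [DecidableEq F]

/-- A set of at most six coordinates on which the nonzero restrictions of codewords have weight at
least four: the sets that witness `(3, 4)`-locality. -/
def IsRepairGroup (C : Submodule F (ι → F)) (R : Finset ι) : Prop :=
  R.card ≤ 6 ∧ ∀ c ∈ C, (∃ i ∈ R, c i ≠ 0) → 4 ≤ (R.filter fun i => c i ≠ 0).card

theorem minDistGE_restrictCode_iff {C : Submodule F (ι → F)} {R : Finset ι} {δ : ℕ} :
    MinDistGE (restrictCode C R) δ ↔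
      ∀ c ∈ C, (∃ i ∈ R, c i ≠ 0) → δ ≤ (R.filter fun i => c i ≠ 0).card := by
  have key : ∀ c : ι → F, hammingNorm (LinearMap.funLeft F F (Subtype.val : {i // i ∈ R} → ι) c) =
      (R.filter fun i => c i ≠ 0).card := by
    intro c
    unfold hammingNorm
    rw [← Finset.card_map (Function.Embedding.subtype (· ∈ R))]
    congr 1
    ext i
    simp only [Finset.mem_map, Finset.mem_filter, Function.Embedding.subtype_apply]
    exact ⟨fun ⟨a, ha, h⟩ => h ▸ ⟨a.2, ha.2⟩, fun h => ⟨⟨i, h.1⟩, ⟨Finset.mem_univ _, h.2⟩, rfl⟩⟩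
  rw [minDistGE_iff]
  constructor
  · rintro h c hc ⟨i, hi, hci⟩
    rw [← key]
    exact h _ (Submodule.mem_map_of_mem hc) fun h0 => hci (congrFun h0 ⟨i, hi⟩)
  · rintro h _ ⟨c, hc, rfl⟩ h0
    obtain ⟨i, hi⟩ := Function.ne_iff.mp h0
    rw [key]
    exact h c hc ⟨i, i.2, hi⟩

theorem isLRC_iff {C : Submodule F (ι → F)} :
    IsLRC C 3 4 ↔ ∀ i, ∃ R : Finset ι, i ∈ R ∧ IsRepairGroup C R := by
  unfold IsLRC IsRepairGroup
  refine forall_congr' fun i => exists_congr fun R => and_congr_right fun _ =>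
    and_congr (by omega) minDistGE_restrictCode_iff

variable [DecidableEq ι] {C : Submodule F (ι → F)} {R S : Finset ι}

theorem IsRepairGroup.vanishingOn_le (hR : IsRepairGroup C R) (h : (R \ S).card ≤ 3) :
    vanishingOn C S ≤ vanishingOn C (S ∪ R) := by
  intro c hc
  rw [mem_vanishingOn] at hc ⊢
  refine ⟨hc.1, fun i hi => ?_⟩
  rcases Finset.mem_union.1 hi with hi | hi
  · exact hc.2 i hi
  by_contra h0
  have h1 := hR.2 c hc.1 ⟨i, hi, h0⟩
  have h2 : (R.filter fun i => c i ≠ 0) ⊆ R \ S := by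
    intro j hj
    rw [Finset.mem_filter] at hj
    exact Finset.mem_sdiff.2 ⟨hj.1, fun hjS => hj.2 (hc.2 j hjS)⟩
  have := Finset.card_le_card h2
  omega

/-- A word of `vanishingOn C S` that is nonzero on a repair group is nonzero on four of its
coordinates outside `S`. -/
theorem IsRepairGroup.four_le_card_sdiff (hR : IsRepairGroup C R)
    (h : ¬ vanishingOn C S ≤ vanishingOn C (S ∪ R)) : 4 ≤ (R \ S).card := by
  by_contra h'
  exact h (hR.vanishingOn_le (by omega))

variable [Fintype ι]

/-- Adjoining a repair group raises the rank by at most `|R \ S| - 3`. -/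
theorem IsRepairGroup.finrank_vanishingOn_union (hR : IsRepairGroup C R)
    (h : 3 ≤ (R \ S).card) :
    Module.finrank F (vanishingOn C S) + 3 ≤
      Module.finrank F (vanishingOn C (S ∪ R)) + (R \ S).card := by
  obtain ⟨T, hT, hTc⟩ := Finset.exists_subset_card_eq (Nat.sub_le (R \ S).card 3)
  have h1 := LRCode.finrank_vanishingOn_union C S T
  have h2 : vanishingOn C (S ∪ T) ≤ vanishingOn C (S ∪ T ∪ R) := by
    apply hR.vanishingOn_le
    rw [show R \ (S ∪ T) = (R \ S) \ T by ext; simp; tauto, Finset.card_sdiff_of_subset hT]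
    omega
  have h3 : S ∪ T ∪ R = S ∪ R := by
    rw [Finset.union_assoc, Finset.union_eq_right.2 (hT.trans Finset.sdiff_subset)]
  rw [h3] at h2
  have := Submodule.finrank_mono h2
  omega

/-- One repair group whose closure is not contained in `S` enlarges `S` so that the dimension of
the words vanishing on it drops by at most three, while its nullity grows by at least three. -/
theorem exists_step (hcov : ∀ i, ∃ R : Finset ι, i ∈ R ∧ IsRepairGroup C R)
    (S : Finset ι) (hS : 1 ≤ Module.finrank F (vanishingOn C S)) :
    ∃ S' : Finset ι, S ⊆ S' ∧
      Module.finrank F (vanishingOn C S) ≤ Module.finrank F (vanishingOn C S') + 3 ∧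
      S.card + Module.finrank F (vanishingOn C S) + 3 ≤
        S'.card + Module.finrank F (vanishingOn C S') := by
  have hne : vanishingOn C S ≠ ⊥ := by
    intro h
    rw [h, finrank_bot] at hS
    omega
  obtain ⟨c, hc, hc0⟩ := Submodule.exists_mem_ne_zero_of_ne_bot hne
  obtain ⟨i, hi⟩ := Function.ne_iff.mp hc0
  obtain ⟨R, hiR, hR⟩ := hcov i
  have h1 : 4 ≤ (R \ S).card := hR.four_le_card_sdiff fun h =>
    hi ((mem_vanishingOn.1 (h hc)).2 i (Finset.mem_union_right S hiR))
  have h2 := hR.finrank_vanishingOn_union (S := S) (by omega)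
  have h3 : (S ∪ R).card = S.card + (R \ S).card := by
    rw [Finset.union_comm, ← Finset.sdiff_union_self_eq_union,
      Finset.card_union_of_disjoint Finset.sdiff_disjoint]
    omega
  have h4 : (R \ S).card ≤ R.card := Finset.card_le_card Finset.sdiff_subset
  have h5 := hR.1
  exact ⟨S ∪ R, Finset.subset_union_left, by omega, by omega⟩

theorem exists_chain (hcov : ∀ i, ∃ R : Finset ι, i ∈ R ∧ IsRepairGroup C R) (m : ℕ)
    (S : Finset ι) (hS : 3 * m ≤ Module.finrank F (vanishingOn C S) + 2) :
    ∃ S' : Finset ι, S ⊆ S' ∧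
      Module.finrank F (vanishingOn C S) ≤ Module.finrank F (vanishingOn C S') + 3 * m ∧
      S.card + Module.finrank F (vanishingOn C S) + 3 * m ≤
        S'.card + Module.finrank F (vanishingOn C S') := by
  induction m with
  | zero => exact ⟨S, subset_rfl, by omega, by omega⟩
  | succ m ih =>
    obtain ⟨S₁, hS₁, h1, h2⟩ := ih (by omega)
    obtain ⟨S₂, hS₂, h3, h4⟩ := exists_step hcov S₁ (by omega)
    exact ⟨S₂, hS₁.trans hS₂, by omega, by omega⟩

/-- The chain of `m` repair groups, trimmed to a prescribed dimension `j` of the vanishing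
subcode. -/
theorem exists_chain_eq (hcov : ∀ i, ∃ R : Finset ι, i ∈ R ∧ IsRepairGroup C R) (m j : ℕ)
    (hj : 1 ≤ j) (S : Finset ι) (hS : 3 * m + j ≤ Module.finrank F (vanishingOn C S)) :
    ∃ S' : Finset ι, S ⊆ S' ∧ Module.finrank F (vanishingOn C S') = j ∧
      S.card + Module.finrank F (vanishingOn C S) + 3 * m ≤ S'.card + j := by
  obtain ⟨S₁, hS₁, h1, h2⟩ := exists_chain hcov m S (by omega)
  obtain ⟨S₂, hS₂, h3, h4⟩ := exists_finrank_vanishingOn_eq C (j := j) S₁ (by omega)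
  exact ⟨S₂, hS₁.trans hS₂, h3, by omega⟩

theorem card_add_le_of_one_le_finrank {d : ℕ} (hmin : ∀ c ∈ C, c ≠ 0 → d ≤ hammingNorm c)
    (hS : 1 ≤ Module.finrank F (vanishingOn C S)) : S.card + d ≤ Fintype.card ι := by
  have hne : vanishingOn C S ≠ ⊥ := by
    intro h
    rw [h, finrank_bot] at hS
    omega
  obtain ⟨c, hc, hc0⟩ := Submodule.exists_mem_ne_zero_of_ne_bot hne
  rw [mem_vanishingOn] at hc
  have h1 : (Finset.univ.filter fun i => c i ≠ 0) ⊆ Sᶜ := by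
    intro i hi
    rw [Finset.mem_compl]
    exact fun h => (Finset.mem_filter.1 hi).2 (hc.2 i h)
  have h2 : hammingNorm c ≤ Sᶜ.card := Finset.card_le_card h1
  have h3 := hmin c hc.1 hc0
  have h4 := Finset.card_compl_add_card S
  omega

theorem five_mul_le_of_two_le_finrank_vanishingOn [Fintype F] (hF : Fintype.card F = 4) {d : ℕ}
    (hmin : ∀ c ∈ C, c ≠ 0 → d ≤ hammingNorm c)
    (hS : 2 ≤ Module.finrank F (vanishingOn C S)) : 5 * d + 4 * S.card ≤ 4 * Fintype.card ι := by
  have h1 := five_mul_le_of_two_le_finrank hF (V := vanishingOn C S) (T := Sᶜ) (d := d)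
    (fun v hv i hi => (mem_vanishingOn.1 hv).2 i (by simpa using hi)) hS
    fun v hv => hmin v (mem_vanishingOn.1 hv).1
  have h4 := Finset.card_compl_add_card S
  omega

/-- If `k = 3 s + t` with `t ∈ {2, 3}`, then `s` repair groups together with further coordinates
leave a two-dimensional code of length at most `d + 1`, which the Plotkin bound excludes. -/
theorem finrank_eq_of_length_eq [Fintype F] (hF : Fintype.card F = 4) {d s t : ℕ} (hd : 5 ≤ d)
    (hmin : ∀ c ∈ C, c ≠ 0 → d ≤ hammingNorm c)
    (hcov : ∀ i, ∃ R : Finset ι, i ∈ R ∧ IsRepairGroup C R)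
    (ht : 1 ≤ t) (hk : Module.finrank F C = 3 * s + t)
    (hn : Fintype.card ι + 1 = 6 * s + d + t) : t = 1 := by
  by_contra h
  have hz : Module.finrank F (vanishingOn C ∅) = 3 * s + t := by rw [vanishingOn_empty, hk]
  obtain ⟨S, -, h1, h2⟩ := exists_chain_eq hcov s 2 (by norm_num) ∅ (by omega)
  have := five_mul_le_of_two_le_finrank_vanishingOn hF hmin h1.ge
  rw [Finset.card_empty] at h2
  omega

/-- The parameters `[6 s + d, 3 s + 1, d]` with `d ≥ 5`, together with `(3, 4)`-locality. -/
structure IsTight (C : Submodule F (ι → F)) (s d : ℕ) : Prop where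
  five_le : 5 ≤ d
  le_hammingNorm : ∀ c ∈ C, c ≠ 0 → d ≤ hammingNorm c
  cover : ∀ i, ∃ R : Finset ι, i ∈ R ∧ IsRepairGroup C R
  finrank_eq : Module.finrank F C = 3 * s + 1
  card_eq : Fintype.card ι = 6 * s + d

namespace IsTight

variable {s d : ℕ}

/-- A coordinate set of nullity at least `3 j` has rank at least `3 j`: otherwise `s - j` further
repair groups leave a two-dimensional subcode whose support is too small for the Plotkin bound. -/
theorem finrank_vanishingOn_le [Fintype F] (hC : IsTight C s d) (hF : Fintype.card F = 4)
    {j : ℕ} (hj : j ≤ s) (h : 3 * s + 1 + 3 * j ≤ S.card + Module.finrank F (vanishingOn C S)) :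
    Module.finrank F (vanishingOn C S) + 3 * j ≤ 3 * s + 1 := by
  by_contra hlt
  obtain ⟨S', -, h1, h2⟩ := exists_chain_eq hC.cover (s - j) 2 (by norm_num) S (by omega)
  have := five_mul_le_of_two_le_finrank_vanishingOn hF hC.le_hammingNorm h1.ge
  have := hC.card_eq
  have := hC.five_le
  omega

/-- A coordinate set of rank at most `3 j` has nullity at most `3 j`: otherwise `s - j` further
repair groups leave a nonzero word of weight less than `d`. -/
theorem card_add_finrank_vanishingOn_le (hC : IsTight C s d) {j : ℕ} (hj : j ≤ s)
    (h : 3 * s + 1 ≤ Module.finrank F (vanishingOn C S) + 3 * j) :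
    S.card + Module.finrank F (vanishingOn C S) ≤ 3 * s + 1 + 3 * j := by
  by_contra hlt
  obtain ⟨S', -, h1, h2⟩ := exists_chain_eq hC.cover (s - j) 1 le_rfl S (by omega)
  have := card_add_le_of_one_le_finrank hC.le_hammingNorm h1.ge
  have := hC.card_eq
  omega

theorem exists_ne_zero (hC : IsTight C s d) (i : ι) : ∃ c ∈ C, c i ≠ 0 := by
  by_contra! h
  have h1 : vanishingOn C {i} = C := by
    apply le_antisymm (vanishingOn_le _ _)
    intro c hc
    rw [mem_vanishingOn]
    exact ⟨hc, by simpa using h c hc⟩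
  have h2 : Module.finrank F (vanishingOn C {i}) = 3 * s + 1 := by rw [h1, hC.finrank_eq]
  have h3 := hC.card_add_finrank_vanishingOn_le (S := {i}) (Nat.zero_le s) (by omega)
  rw [Finset.card_singleton] at h3
  omega

/-- Every repair group of a tight code has six coordinates and rank three. -/
theorem finrank_group [Fintype F] (hC : IsTight C s d) (hF : Fintype.card F = 4) (hs : 1 ≤ s)
    {i : ι} (hi : i ∈ R) (hR : IsRepairGroup C R) :
    R.card = 6 ∧ Module.finrank F (vanishingOn C R) + 3 = 3 * s + 1 := by
  obtain ⟨c, hc, hci⟩ := hC.exists_ne_zero i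
  have h0 : Module.finrank F (vanishingOn C ∅) = 3 * s + 1 := by
    rw [vanishingOn_empty, hC.finrank_eq]
  have h1 : 4 ≤ (R \ ∅).card := hR.four_le_card_sdiff fun h =>
    hci ((mem_vanishingOn.1 (h (by rwa [vanishingOn_empty]))).2 i (Finset.mem_union_right _ hi))
  have h2 := hR.finrank_vanishingOn_union (S := ∅) (by omega)
  rw [Finset.empty_union, Finset.sdiff_empty] at h2
  have h3 := hC.finrank_vanishingOn_le hF (S := R) hs (by omega)
  have := hR.1
  omega

/-- A repair group that is not contained in another one adds at least four coordinates. -/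
theorem four_le_card_sdiff [Fintype F] (hC : IsTight C s d) (hF : Fintype.card F = 4)
    (hs : 1 ≤ s) {R' : Finset ι} (hR : IsRepairGroup C R) (hR' : IsRepairGroup C R') {i j : ι}
    (hi : i ∈ R) (hj : j ∈ R') (hjR : j ∉ R) : 4 ≤ (R' \ R).card := by
  apply hR'.four_le_card_sdiff
  intro h
  have h1 := hC.finrank_group hF hs hi hR
  have h2 := Submodule.finrank_mono h
  have h3 := hC.card_add_finrank_vanishingOn_le (S := R ∪ R') hs (by omega)
  have h4 : (insert j R).card ≤ (R ∪ R').card := Finset.card_le_card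
    (Finset.insert_subset (Finset.mem_union_right _ hj) Finset.subset_union_left)
  rw [Finset.card_insert_of_notMem hjR] at h4
  omega

/-- For `s ≥ 2` the union of two different repair groups has rank six, so they are disjoint. -/
theorem disjoint_groups [Fintype F] (hC : IsTight C s d) (hF : Fintype.card F = 4) (hs : 2 ≤ s)
    {R' : Finset ι} (hR : IsRepairGroup C R) (hR' : IsRepairGroup C R') {i : ι}
    (hi : i ∈ R) (hne : R ≠ R') : Disjoint R R' := by
  rcases R'.eq_empty_or_nonempty with rfl | ⟨j₀, hj₀⟩
  · exact Finset.disjoint_empty_right R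
  have h1 := hC.finrank_group hF (by omega) hi hR
  have h2 := hC.finrank_group hF (by omega) hj₀ hR'
  have h3 : ¬ R' ⊆ R := fun h => hne (Finset.eq_of_subset_of_card_le h (by omega)).symm
  obtain ⟨j, hj, hjR⟩ := Finset.not_subset.1 h3
  have h4 := hC.four_le_card_sdiff hF (by omega) hR hR' hi hj hjR
  have h5 := hR'.finrank_vanishingOn_union (S := R) (by omega)
  have h6 : (R ∪ R').card = R.card + (R' \ R).card := by
    rw [Finset.union_comm, ← Finset.sdiff_union_self_eq_union,
      Finset.card_union_of_disjoint Finset.sdiff_disjoint]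
    omega
  have h7 := hC.finrank_vanishingOn_le hF (S := R ∪ R') (j := 2) hs (by omega)
  have h8 : R' \ R = R' := Finset.eq_of_subset_of_card_le Finset.sdiff_subset (by omega)
  exact (Finset.sdiff_eq_self_iff_disjoint.1 h8).symm

/-- Shortening at `s - 1` repair groups. -/
theorem exists_four_dim (hC : IsTight C s d) (hs : 1 ≤ s) :
    ∃ S : Finset ι, Module.finrank F (vanishingOn C S) = 4 ∧ (Sᶜ).card ≤ d + 6 := by
  have h0 : Module.finrank F (vanishingOn C ∅) = 3 * s + 1 := by
    rw [vanishingOn_empty, hC.finrank_eq]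
  obtain ⟨S, -, h1, h2⟩ := exists_chain_eq hC.cover (s - 1) 4 (by norm_num) ∅ (by omega)
  have h3 := Finset.card_compl_add_card S
  have := hC.card_eq
  rw [Finset.card_empty] at h2
  exact ⟨S, h1, by omega⟩

end IsTight

end RepairGroups

/-! ### Pencils and caps -/

section Caps

variable {F V : Type*} [Field F] [AddCommGroup V] [Module F V]

open Classical in
/-- The number of vectors of `K` in the subspace `U`. -/
noncomputable def numIn (K : Finset V) (U : Submodule F V) : ℕ :=
  (K.filter (· ∈ U)).card

theorem numIn_top (K : Finset V) : numIn K (⊤ : Submodule F V) = K.card := by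
  simp [numIn]

theorem numIn_mono (K : Finset V) {U W : Submodule F V} (h : U ≤ W) : numIn K U ≤ numIn K W := by
  classical
  exact Finset.card_le_card fun x hx => by
    rw [Finset.mem_filter] at hx ⊢
    exact ⟨hx.1, h hx.2⟩

theorem numIn_pos {K : Finset V} {U : Submodule F V} {x : V} (hx : x ∈ K) (hU : x ∈ U) :
    1 ≤ numIn K U :=
  Finset.card_pos.2 ⟨x, by simp [hx, hU]⟩

theorem exists_of_numIn_pos {K : Finset V} {U : Submodule F V} (h : 1 ≤ numIn K U) :
    ∃ x ∈ K, x ∈ U := by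
  obtain ⟨x, hx⟩ := Finset.card_pos.1 h
  exact ⟨x, by simpa using hx⟩

theorem two_le_numIn {K : Finset V} {U : Submodule F V} {x y : V} (hx : x ∈ K) (hU : x ∈ U)
    (hy : y ∈ K) (hyU : y ∈ U) (hxy : x ≠ y) : 2 ≤ numIn K U :=
  Finset.one_lt_card.2 ⟨x, by simp [hx, hU], y, by simp [hy, hyU], hxy⟩

variable {U W H : Submodule F V}

section

variable [FiniteDimensional F V]

theorem finrank_sup_span_singleton {x : V} (hx : x ∉ U) :
    Module.finrank F (U ⊔ Submodule.span F {x} : Submodule F V) = Module.finrank F U + 1 := by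
  have h1 := Submodule.finrank_sup_add_finrank_inf_eq U (Submodule.span F {x})
  have h2 : U ⊓ Submodule.span F {x} = ⊥ := by
    rw [← disjoint_iff, Submodule.disjoint_span_singleton]
    exact fun h => absurd h hx
  have h3 : Module.finrank F (Submodule.span F {x}) = 1 :=
    finrank_span_singleton fun h => hx (h ▸ U.zero_mem)
  rw [h2, finrank_bot] at h1
  omega

theorem eq_sup_span_singleton {x : V} (hx : x ∉ U) (hUH : U ≤ H) (hxH : x ∈ H)
    (hH : Module.finrank F H = Module.finrank F U + 1) : H = U ⊔ Submodule.span F {x} := by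
  symm
  apply Submodule.eq_of_le_of_finrank_eq
  · exact sup_le hUH ((Submodule.span_singleton_le_iff_mem _ _).2 hxH)
  · rw [finrank_sup_span_singleton hx, hH]

end

variable [Finite V]

/-- The subspaces strictly between `U` and `W`. For `dim W = dim U + 2` this is a pencil: the points
of a line, the lines of a plane through a point, the planes of space through a line. -/
noncomputable def pencil (U W : Submodule F V) : Finset (Submodule F V) :=
  (Set.toFinite {H : Submodule F V | U < H ∧ H < W}).toFinset

theorem mem_pencil {U W H : Submodule F V} : H ∈ pencil U W ↔ U < H ∧ H < W := by
  simp [pencil]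

theorem finrank_of_mem_pencil (hd : Module.finrank F W = Module.finrank F U + 2)
    (hH : H ∈ pencil U W) : Module.finrank F H = Module.finrank F U + 1 := by
  rw [mem_pencil] at hH
  have h1 := Submodule.finrank_lt_finrank_of_lt hH.1
  have h2 := Submodule.finrank_lt_finrank_of_lt hH.2
  omega

theorem mem_pencil_of_finrank (hd : Module.finrank F W = Module.finrank F U + 2) (h1 : U ≤ H)
    (h2 : H ≤ W) (h3 : Module.finrank F H = Module.finrank F U + 1) : H ∈ pencil U W := by
  rw [mem_pencil]
  refine ⟨lt_of_le_of_ne h1 ?_, lt_of_le_of_ne h2 ?_⟩ <;> rintro rfl <;> omega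

/-- Every vector of `W` outside `U` lies in exactly one member of the pencil. -/
theorem numIn_add_card_pencil_mul (hd : Module.finrank F W = Module.finrank F U + 2)
    (hUW : U ≤ W) (K : Finset V) :
    numIn K W + (pencil U W).card * numIn K U = ∑ H ∈ pencil U W, numIn K H + numIn K U := by
  classical
  simp only [numIn, Finset.card_filter]
  rw [Finset.sum_comm, Finset.mul_sum, ← Finset.sum_add_distrib, ← Finset.sum_add_distrib]
  apply Finset.sum_congr rfl
  intro x _
  by_cases hxU : x ∈ U
  · have h1 : ∀ H ∈ pencil U W, (if x ∈ H then 1 else 0) = 1 := fun H hH =>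
      if_pos ((mem_pencil.1 hH).1.le hxU)
    rw [Finset.sum_congr rfl h1]
    simp [hxU, hUW hxU, add_comm]
  · by_cases hxW : x ∈ W
    · have hmem : U ⊔ Submodule.span F {x} ∈ pencil U W :=
        mem_pencil_of_finrank hd le_sup_left
          (sup_le hUW ((Submodule.span_singleton_le_iff_mem _ _).2 hxW))
          (finrank_sup_span_singleton hxU)
      rw [Finset.sum_eq_single_of_mem _ hmem]
      · simp [hxU, hxW, Submodule.mem_sup_right (Submodule.mem_span_singleton_self x)]
      · intro H hH hne
        rw [if_neg]
        intro hxH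
        exact hne (eq_sup_span_singleton hxU (mem_pencil.1 hH).1.le hxH
          (finrank_of_mem_pencil hd hH))
    · have h1 : ∀ H ∈ pencil U W, (if x ∈ H then 1 else 0) = 0 := fun H hH =>
        if_neg fun h => hxW ((mem_pencil.1 hH).2.le h)
      rw [Finset.sum_congr rfl h1]
      simp [hxU, hxW]

theorem card_pencil [Fintype F] (hF : Fintype.card F = 4)
    (hd : Module.finrank F W = Module.finrank F U + 2) (hUW : U ≤ W) :
    (pencil U W).card = 5 := by
  classical
  have : Fintype V := Fintype.ofFinite V
  -- apply the incidence count to the set of all vectors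
  have hcard : ∀ X : Submodule F V, numIn Finset.univ X = 4 ^ Module.finrank F X := by
    intro X
    rw [numIn, ← Fintype.card_subtype, ← hF]
    exact Module.card_eq_pow_finrank (K := F) (V := X)
  have h := numIn_add_card_pencil_mul hd hUW Finset.univ
  rw [Finset.sum_congr rfl fun H hH => by rw [hcard H, finrank_of_mem_pencil hd hH],
    Finset.sum_const, hcard, hcard, hd, smul_eq_mul, pow_succ, pow_succ] at h
  have hpos : 0 < 4 ^ Module.finrank F U := by positivity
  set u := 4 ^ Module.finrank F U
  nlinarith

theorem numIn_add_four_mul [Fintype F] (hF : Fintype.card F = 4)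
    (hd : Module.finrank F W = Module.finrank F U + 2) (hUW : U ≤ W) (K : Finset V) :
    numIn K W + 4 * numIn K U = ∑ H ∈ pencil U W, numIn K H := by
  have h := numIn_add_card_pencil_mul hd hUW K
  rw [card_pencil hF hd hUW] at h
  omega

/-- A set of points (each represented by a vector) of which no three are collinear. -/
def IsCap (F : Type*) {V : Type*} [Field F] [AddCommGroup V] [Module F V] (K : Finset V) : Prop :=
  ∀ L : Submodule F V, Module.finrank F L = 2 → numIn K L ≤ 2

namespace IsCap

variable {K : Finset V}

theorem numIn_le_one (hK : IsCap F K) (h3 : 3 ≤ K.card)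
    (hV : 2 ≤ Module.finrank F V) {Q : Submodule F V} (hQ : Module.finrank F Q = 1) :
    numIn K Q ≤ 1 := by
  classical
  by_contra hlt
  have key : ∃ L : Submodule F V, Module.finrank F L = 2 ∧ 3 ≤ numIn K L := by
    by_cases h : ∃ r ∈ K, r ∉ Q
    · obtain ⟨r, hr, hrQ⟩ := h
      refine ⟨Q ⊔ Submodule.span F {r}, by rw [finrank_sup_span_singleton hrQ, hQ], ?_⟩
      have h1 : insert r (K.filter (· ∈ Q)) ⊆ K.filter (· ∈ Q ⊔ Submodule.span F {r}) := by
        intro x hx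
        rw [Finset.mem_insert, Finset.mem_filter] at hx
        rw [Finset.mem_filter]
        rcases hx with rfl | hx
        · exact ⟨hr, Submodule.mem_sup_right (Submodule.mem_span_singleton_self _)⟩
        · exact ⟨hx.1, Submodule.mem_sup_left hx.2⟩
      have h2 := Finset.card_le_card h1
      rw [Finset.card_insert_of_notMem (by simp [hrQ])] at h2
      have h3 : (K.filter (· ∈ Q)).card = numIn K Q := by simp [numIn]
      have h4 : (K.filter (· ∈ Q ⊔ Submodule.span F {r})).card =
        numIn K (Q ⊔ Submodule.span F {r}) := by simp [numIn]
      omega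
    · push Not at h
      obtain ⟨L, hL, -, hL2⟩ := exists_submodule_finrank_eq (F := F) (U := Q) (W := ⊤) (m := 2)
        le_top (by omega) (by rw [finrank_top]; exact hV)
      refine ⟨L, hL2, ?_⟩
      have h1 : numIn K L = K.card := by
        unfold numIn
        congr 1
        exact Finset.filter_true_of_mem fun x hx => hL (h x hx)
      omega
  obtain ⟨L, hL, h⟩ := key
  have := hK L hL
  omega

theorem ne_zero (hK : IsCap F K) (h3 : 3 ≤ K.card) (hV : 2 ≤ Module.finrank F V) {p : V}
    (hp : p ∈ K) : p ≠ 0 := by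
  rintro rfl
  obtain ⟨q, hq, hq0⟩ := Finset.exists_mem_ne (s := K) (by omega) (0 : V)
  have h1 := hK.numIn_le_one h3 hV (finrank_span_singleton (K := F) hq0)
  have h2 := two_le_numIn hp (Submodule.zero_mem (Submodule.span F {q})) hq
    (Submodule.mem_span_singleton_self q) hq0.symm
  omega

theorem numIn_span_singleton (hK : IsCap F K) (h3 : 3 ≤ K.card) (hV : 2 ≤ Module.finrank F V)
    {p : V} (hp : p ∈ K) : numIn K (Submodule.span F {p}) = 1 := by
  have h1 := hK.numIn_le_one h3 hV (finrank_span_singleton (K := F) (hK.ne_zero h3 hV hp))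
  have h2 := numIn_pos hp (Submodule.mem_span_singleton_self (R := F) p)
  omega

end IsCap
end Caps

/-! ### Plane sections with five points -/

section CapBound

theorem sum_le_of_two {α : Type*} {P : Finset α} (hP : P.card = 5) {f : α → ℕ}
    (hf : ∀ a ∈ P, f a ≤ 2) {a b : α} (ha : a ∈ P) (hb : b ∈ P) (hab : a ≠ b) (hfa : f a ≤ 1)
    (hfb : f b ≤ 1) : ∑ x ∈ P, f x ≤ 8 := by
  classical
  have hb' : b ∈ P.erase a := Finset.mem_erase.2 ⟨hab.symm, hb⟩
  have h1 := Finset.add_sum_erase P f ha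
  have h2 := Finset.add_sum_erase (P.erase a) f hb'
  have h3 := Finset.sum_le_card_nsmul ((P.erase a).erase b) (fun x => f x) 2 fun x hx =>
    hf x (Finset.mem_of_mem_erase (Finset.mem_of_mem_erase hx))
  rw [Finset.card_erase_of_mem hb', Finset.card_erase_of_mem ha, hP] at h3
  simp only [smul_eq_mul] at h3
  omega

variable {F V : Type*} [Field F] [AddCommGroup V] [Module F V] [Finite V]
  {K : Finset V} {L M Q π : Submodule F V}

/-- Two distinct lines meet in at most a point. -/
theorem line_eq_of_finrank (hL : Module.finrank F L = 2) (hM : Module.finrank F M = 2)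
    (hQ : Module.finrank F Q = 1) (hQL : Q ≤ L) (hQM : Q ≤ M) {x : V} (hx : x ∉ Q)
    (hxL : x ∈ L) (hxM : x ∈ M) : L = M := by
  rw [eq_sup_span_singleton hx hQL hxL (by omega), eq_sup_span_singleton hx hQM hxM (by omega)]

theorem line_eq_of_points {Q' : Submodule F V} (hL : Module.finrank F L = 2)
    (hM : Module.finrank F M = 2) (hQ : Module.finrank F Q = 1) (hQ' : Module.finrank F Q' = 1)
    (hne : Q ≠ Q') (hQL : Q ≤ L) (hQM : Q ≤ M) (hQL' : Q' ≤ L) (hQM' : Q' ≤ M) : L = M := by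
  have h : ¬ Q' ≤ Q := fun h => hne (Submodule.eq_of_le_of_finrank_eq h (by omega)).symm
  obtain ⟨x, hx, hxQ⟩ := SetLike.not_le_iff_exists.1 h
  exact line_eq_of_finrank hL hM hQ hQL hQM hxQ (hQL' hx) (hQM' hx)

variable [Fintype F]

namespace IsCap

variable (hF : Fintype.card F = 4) (hK : IsCap F K) (h3 : 3 ≤ K.card)
  (hV : 2 ≤ Module.finrank F V)

include hF hK h3 hV

/-- The five lines through a point of the cap in a plane cover the plane, and the point itself is
counted five times. -/
theorem sum_pencil_span_singleton {p : V} (hp : p ∈ K) (hpπ : p ∈ π)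
    (hπ : Module.finrank F π = 3) :
    numIn K π + 4 = ∑ L ∈ pencil (Submodule.span F {p}) π, numIn K L := by
  have h1 := finrank_span_singleton (K := F) (hK.ne_zero h3 hV hp)
  have h2 := numIn_add_four_mul hF (U := Submodule.span F {p}) (W := π) (by omega)
    ((Submodule.span_singleton_le_iff_mem _ _).2 hpπ) K
  rw [hK.numIn_span_singleton h3 hV hp] at h2
  omega

omit [Fintype F] hF in
theorem mem_pencil_span_singleton {p : V} (hp : p ∈ K) (hπ : Module.finrank F π = 3) :
    L ∈ pencil (Submodule.span F {p}) π ↔ p ∈ L ∧ L ≤ π ∧ Module.finrank F L = 2 := by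
  have h1 := finrank_span_singleton (K := F) (hK.ne_zero h3 hV hp)
  constructor
  · intro h
    refine ⟨(Submodule.span_singleton_le_iff_mem _ _).1 (mem_pencil.1 h).1.le,
      (mem_pencil.1 h).2.le, ?_⟩
    rw [finrank_of_mem_pencil (by omega) h, h1]
  · rintro ⟨h4, h5, h6⟩
    exact mem_pencil_of_finrank (by omega) ((Submodule.span_singleton_le_iff_mem _ _).2 h4) h5
      (by omega)

theorem card_pencil_span_singleton {p : V} (hp : p ∈ K) (hpπ : p ∈ π)
    (hπ : Module.finrank F π = 3) : (pencil (Submodule.span F {p}) π).card = 5 :=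
  card_pencil hF (by rw [hπ, finrank_span_singleton (K := F) (hK.ne_zero h3 hV hp)])
    ((Submodule.span_singleton_le_iff_mem _ _).2 hpπ)

/-- A plane that contains a tangent line has at most five points. -/
theorem numIn_le_five_of_tangent (hπ : Module.finrank F π = 3) (hL : Module.finrank F L = 2)
    (hLπ : L ≤ π) (ht : numIn K L = 1) : numIn K π ≤ 5 := by
  classical
  obtain ⟨p, hp, hpL⟩ := exists_of_numIn_pos ht.ge
  have h1 := hK.sum_pencil_span_singleton hF h3 hV hp (hLπ hpL) hπ
  have hmem := (hK.mem_pencil_span_singleton h3 hV hp hπ (L := L)).2 ⟨hpL, hLπ, hL⟩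
  rw [← Finset.add_sum_erase _ _ hmem] at h1
  have h2 := Finset.sum_le_card_nsmul ((pencil (Submodule.span F {p}) π).erase L)
    (fun X => numIn K X) 2 fun M hM => hK M
      ((hK.mem_pencil_span_singleton h3 hV hp hπ).1 (Finset.mem_of_mem_erase hM)).2.2
  rw [Finset.card_erase_of_mem hmem,
    hK.card_pencil_span_singleton hF h3 hV hp (hLπ hpL) hπ, smul_eq_mul] at h2
  omega

/-- Five lines through a point of the cap carry the other four points of the plane section, at
most one each, so one of them is a tangent. -/
theorem exists_tangent_of_five (hπ : Module.finrank F π = 3) (h5 : numIn K π = 5) {p : V}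
    (hp : p ∈ K) (hpπ : p ∈ π) :
    ∃ L ≤ π, Module.finrank F L = 2 ∧ p ∈ L ∧ numIn K L = 1 := by
  by_contra! h
  have h1 := hK.sum_pencil_span_singleton hF h3 hV hp hpπ hπ
  have h2 : ∀ L ∈ pencil (Submodule.span F {p}) π, numIn K L = 2 := by
    intro L hL
    obtain ⟨hpL, hLπ, hL2⟩ := (hK.mem_pencil_span_singleton h3 hV hp hπ).1 hL
    have := h L hLπ hL2 hpL
    have := hK L hL2
    have := numIn_pos hp hpL
    omega
  rw [Finset.sum_congr rfl h2, Finset.sum_const,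
    hK.card_pencil_span_singleton hF h3 hV hp hpπ hπ, smul_eq_mul] at h1
  omega

theorem tangent_unique_of_five (hπ : Module.finrank F π = 3) (h5 : numIn K π = 5) {p : V}
    (hp : p ∈ K) (hL : Module.finrank F L = 2) (hM : Module.finrank F M = 2) (hLπ : L ≤ π)
    (hMπ : M ≤ π) (hpL : p ∈ L) (hpM : p ∈ M) (htL : numIn K L = 1) (htM : numIn K M = 1) :
    L = M := by
  by_contra hne
  have h1 := hK.sum_pencil_span_singleton hF h3 hV hp (hLπ hpL) hπ
  have h2 := sum_le_of_two (hK.card_pencil_span_singleton hF h3 hV hp (hLπ hpL) hπ)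
    (f := numIn K) (fun X hX =>
      hK X ((hK.mem_pencil_span_singleton h3 hV hp hπ).1 hX).2.2)
    ((hK.mem_pencil_span_singleton h3 hV hp hπ).2 ⟨hpL, hLπ, hL⟩)
    ((hK.mem_pencil_span_singleton h3 hV hp hπ).2 ⟨hpM, hMπ, hM⟩) hne htL.le htM.le
  omega

omit h3 hV in
/-- In a plane with five points, every point off the cap lies on a tangent, by parity. -/
theorem exists_tangent_through_of_five (hπ : Module.finrank F π = 3) (h5 : numIn K π = 5)
    (hQ : Module.finrank F Q = 1) (hQπ : Q ≤ π) (hQ0 : numIn K Q = 0) :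
    ∃ L ≤ π, Module.finrank F L = 2 ∧ Q ≤ L ∧ numIn K L = 1 := by
  by_contra! h
  have h1 := numIn_add_four_mul hF (U := Q) (W := π) (by omega) hQπ K
  have h2 : 2 ∣ ∑ L ∈ pencil Q π, numIn K L := by
    apply Finset.dvd_sum
    intro L hL
    have hL2 : Module.finrank F L = 2 := by rw [finrank_of_mem_pencil (by omega) hL, hQ]
    have := h L (mem_pencil.1 hL).2.le hL2 (mem_pencil.1 hL).1.le
    have := hK L hL2
    have h3 : numIn K L = 0 ∨ numIn K L = 2 := by omega
    rcases h3 with h3 | h3 <;> rw [h3]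
    exact dvd_zero 2
  omega

/-- In a plane with five points, a point off the cap that lies on a secant lies on only one tangent:
the three points of the secant off the cap lie on tangents at three different points off the
secant. -/
theorem tangent_unique_of_secant (hπ : Module.finrank F π = 3) (h5 : numIn K π = 5)
    {S : Submodule F V} (hS : Module.finrank F S = 2) (hSπ : S ≤ π) (hS2 : numIn K S = 2)
    (hQ : Module.finrank F Q = 1) (hQS : Q ≤ S) (hQ0 : numIn K Q = 0)
    (hL : Module.finrank F L = 2) (hLπ : L ≤ π) (hQL : Q ≤ L) (htL : numIn K L = 1)
    (hM : Module.finrank F M = 2) (hMπ : M ≤ π) (hQM : Q ≤ M) (htM : numIn K M = 1) :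
    L = M := by
  classical
  -- `O` is the set of points of the secant off the cap
  set O := (pencil ⊥ S).filter fun Q => numIn K Q = 0 with hO
  set R := K.filter fun x => x ∈ π ∧ x ∉ S with hR
  have hbot : numIn K (⊥ : Submodule F V) = 0 := by
    rw [numIn, Finset.card_eq_zero, Finset.filter_eq_empty_iff]
    intro x hx h
    exact hK.ne_zero h3 hV hx ((Submodule.mem_bot F).1 h)
  have hdim : ∀ X ∈ pencil ⊥ S, Module.finrank F X = 1 := fun X hX => by
    rw [finrank_of_mem_pencil (by rw [hS, finrank_bot]) hX, finrank_bot]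
  have hmemO : ∀ X : Submodule F V,
      X ∈ O ↔ Module.finrank F X = 1 ∧ X ≤ S ∧ numIn K X = 0 := by
    intro X
    rw [hO, Finset.mem_filter]
    constructor
    · rintro ⟨h1, h2⟩
      exact ⟨hdim X h1, (mem_pencil.1 h1).2.le, h2⟩
    · rintro ⟨h1, h2, h4⟩
      exact ⟨mem_pencil_of_finrank (by rw [hS, finrank_bot]) bot_le h2
        (by rw [h1, finrank_bot]), h4⟩
  have hOcard : O.card = 3 := by
    have h1 := numIn_add_four_mul hF (U := ⊥) (W := S) (by rw [hS, finrank_bot]) bot_le K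
    have h2 : ∑ X ∈ pencil ⊥ S, numIn K X =
        ((pencil ⊥ S).filter fun X => ¬ numIn K X = 0).card := by
      rw [Finset.card_filter]
      apply Finset.sum_congr rfl
      intro X hX
      have := hK.numIn_le_one h3 hV (hdim X hX)
      split_ifs <;> omega
    have h4 := Finset.card_filter_add_card_filter_not (s := pencil ⊥ S)
      (fun X => numIn K X = 0)
    rw [card_pencil hF (by rw [hS, finrank_bot]) bot_le, ← h2, ← hO] at h4
    omega
  have hRcard : R.card = 3 := by
    have h1 : numIn K π = numIn K S + R.card := by
      unfold numIn
      rw [← Finset.card_filter_add_card_filter_not (s := K.filter (· ∈ π)) (fun x => x ∈ S),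
        Finset.filter_filter, Finset.filter_filter]
      congr 2
      ext x
      simp only [Finset.mem_filter]
      exact ⟨fun h => ⟨h.1, h.2.2⟩, fun h => ⟨h.1, hSπ h.2, h.2⟩⟩
    omega
  -- a point off the secant on a tangent through a point of `O`
  have hmemR : ∀ X ∈ O, ∀ T ≤ π, Module.finrank F T = 2 → X ≤ T → numIn K T = 1 →
      ∃ r ∈ R, r ∈ T := by
    intro X hX T hTπ hT hXT hT1
    rw [hmemO] at hX
    obtain ⟨r, hr, hrT⟩ := exists_of_numIn_pos hT1.ge
    refine ⟨r, ?_, hrT⟩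
    rw [hR, Finset.mem_filter]
    refine ⟨hr, hTπ hrT, fun hrS => ?_⟩
    have hrX : r ∉ X := fun h => by
      have := numIn_pos hr h
      omega
    have := line_eq_of_finrank hT hS hX.1 hXT hX.2.1 hrX hrT hrS
    rw [this] at hT1
    omega
  have hex : ∀ X ∈ O, ∃ r ∈ R, ∃ T ≤ π, Module.finrank F T = 2 ∧ X ≤ T ∧ numIn K T = 1 ∧
      r ∈ T := by
    intro X hX
    have hX' := (hmemO X).1 hX
    obtain ⟨T, hTπ, hT, hXT, hT1⟩ := hK.exists_tangent_through_of_five hF hπ h5 hX'.1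
      (hX'.2.1.trans hSπ) hX'.2.2
    obtain ⟨r, hr, hrT⟩ := hmemR X hX T hTπ hT hXT hT1
    exact ⟨r, hr, T, hTπ, hT, hXT, hT1, hrT⟩
  choose! r hrR T hTπ hT hXT hT1 hrT using hex
  have huniq : ∀ X ∈ O, ∀ Y ∈ O, ∀ T ≤ π, Module.finrank F T = 2 → numIn K T = 1 → X ≤ T →
      Y ≤ T → X = Y := by
    intro X hX Y hY T _ hT hT1 hXT hYT
    rw [hmemO] at hX hY
    by_contra hne
    have := line_eq_of_points hT hS hX.1 hY.1 hne hXT hX.2.1 hYT hY.2.1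
    rw [this] at hT1
    omega
  have hinj : Set.InjOn r O := by
    intro X hX Y hY hXY
    have hr := (Finset.mem_filter.1 (hrR X hX)).1
    have hTT : T X = T Y := hK.tangent_unique_of_five hF h3 hV hπ h5 hr (hT X hX) (hT Y hY)
      (hTπ X hX) (hTπ Y hY) (hrT X hX) (hXY ▸ hrT Y hY) (hT1 X hX) (hT1 Y hY)
    exact huniq X hX Y hY (T X) (hTπ X hX) (hT X hX) (hT1 X hX) (hXT X hX)
      (hTT ▸ hXT Y hY)
  have hsurj : Set.SurjOn r O R := Finset.surjOn_of_injOn_of_card_le r hrR hinj (by omega)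
  have hQO : Q ∈ O := (hmemO Q).2 ⟨hQ, hQS, hQ0⟩
  have hfinal : ∀ N ≤ π, Module.finrank F N = 2 → Q ≤ N → numIn K N = 1 → N = T Q := by
    intro N hNπ hN hQN hN1
    obtain ⟨x, hxR, hxN⟩ := hmemR Q hQO N hNπ hN hQN hN1
    obtain ⟨X, hX, rfl⟩ := hsurj hxR
    have hr := (Finset.mem_filter.1 hxR).1
    have hNT : N = T X := hK.tangent_unique_of_five hF h3 hV hπ h5 hr hN (hT X hX) hNπ
      (hTπ X hX) hxN (hrT X hX) hN1 (hT1 X hX)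
    have hQX : Q = X := huniq Q hQO X hX N hNπ hN hN1 hQN (hNT ▸ hXT X hX)
    rw [hNT, hQX]
  rw [hfinal L hLπ hL hQL htL, hfinal M hMπ hM hQM htM]

/-- The nucleus of a plane section with five points: a point of the plane all of whose lines in the
plane are tangents. -/
theorem exists_nucleus (hπ : Module.finrank F π = 3) (h5 : numIn K π = 5) :
    ∃ N ≤ π, Module.finrank F N = 1 ∧ numIn K N = 0 ∧
      ∀ L ≤ π, Module.finrank F L = 2 → N ≤ L → numIn K L = 1 := by
  classical
  obtain ⟨p, hp, q, hq, hpq⟩ := Finset.one_lt_card.1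
    (show 1 < (K.filter (· ∈ π)).card by
      have : (K.filter (· ∈ π)).card = numIn K π := by simp [numIn]
      omega)
  rw [Finset.mem_filter] at hp hq
  obtain ⟨L, hLπ, hL, hpL, hL1⟩ := hK.exists_tangent_of_five hF h3 hV hπ h5 hp.1 hp.2
  obtain ⟨M, hMπ, hM, hqM, hM1⟩ := hK.exists_tangent_of_five hF h3 hV hπ h5 hq.1 hq.2
  have hqL : q ∉ L := fun h => by
    have := two_le_numIn hp.1 hpL hq.1 h hpq
    omega
  have hLM : L ≠ M := by
    rintro rfl
    exact hqL hqM
  have hN : Module.finrank F (L ⊓ M : Submodule F V) = 1 := by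
    have h1 := Submodule.finrank_sup_add_finrank_inf_eq L M
    have h2 := Submodule.finrank_mono (sup_le hLπ hMπ)
    have h4 : L ⊓ M < L := lt_of_le_of_ne inf_le_left fun h => hLM
      (Submodule.eq_of_le_of_finrank_eq (inf_eq_left.1 h) (by omega))
    have := Submodule.finrank_lt_finrank_of_lt h4
    omega
  have hN0 : numIn K (L ⊓ M) = 0 := by
    by_contra h
    obtain ⟨x, hx, hxL, hxM⟩ := exists_of_numIn_pos (Nat.one_le_iff_ne_zero.2 h)
    have hxp : x = p := by
      by_contra hne
      have := two_le_numIn hx hxL hp.1 hpL hne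
      omega
    have hxq : x = q := by
      by_contra hne
      have := two_le_numIn hx hxM hq.1 hqM hne
      omega
    exact hpq (hxp.symm.trans hxq)
  refine ⟨L ⊓ M, inf_le_left.trans hLπ, hN, hN0, ?_⟩
  have hno : ∀ S ≤ π, Module.finrank F S = 2 → L ⊓ M ≤ S → numIn K S ≤ 1 := by
    intro S hSπ hS hNS
    by_contra hlt
    have := hK S hS
    exact hLM (hK.tangent_unique_of_secant hF h3 hV hπ h5 hS hSπ (by omega) hN hNS hN0 hL hLπ
      inf_le_left hL1 hM hMπ inf_le_right hM1)
  intro S hSπ hS hNS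
  have hmem : ∀ X ∈ pencil (L ⊓ M) π, numIn K X ≤ 1 := fun X hX =>
    hno X (mem_pencil.1 hX).2.le (by rw [finrank_of_mem_pencil (by omega) hX, hN])
      (mem_pencil.1 hX).1.le
  have hSmem : S ∈ pencil (L ⊓ M) π := mem_pencil_of_finrank (by omega) hNS hSπ (by omega)
  have h1 := numIn_add_four_mul hF (U := L ⊓ M) (W := π) (by omega) (inf_le_left.trans hLπ) K
  rw [← Finset.add_sum_erase _ _ hSmem] at h1
  have h2 := Finset.sum_le_card_nsmul ((pencil (L ⊓ M) π).erase S)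
    (fun X => numIn K X) 1 fun X hX => hmem X (Finset.mem_of_mem_erase hX)
  rw [Finset.card_erase_of_mem hSmem, card_pencil hF (by omega) (inf_le_left.trans hLπ),
    smul_eq_mul] at h2
  have := hmem S hSmem
  omega

end IsCap

end CapBound

/-! ### Caps have at most seventeen points -/

section CapBoundFinal

variable {F V : Type*} [Field F] [Fintype F] [AddCommGroup V] [Module F V] [Finite V]
  {K : Finset V}

/-- If a cap with at least `18` points had a tangent line, some plane through it would contain five
points; a secant through the nucleus `N` of that section would lie on planes with at most five
points only, so `N` extends the cap. -/
theorem IsCap.exists_larger (hF : Fintype.card F = 4) (hK : IsCap F K) (h18 : 18 ≤ K.card)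
    (hV : Module.finrank F V = 4) {L : Submodule F V} (hL : Module.finrank F L = 2)
    (hL1 : numIn K L = 1) : ∃ K' : Finset V, IsCap F K' ∧ K.card < K'.card := by
  classical
  have h3 : 3 ≤ K.card := by omega
  have htop : Module.finrank F (⊤ : Submodule F V) = 4 := by rw [finrank_top, hV]
  -- a plane with five points
  obtain ⟨π, hπL, hπ5⟩ : ∃ π ∈ pencil L ⊤, numIn K π = 5 := by
    by_contra! h
    have h1 := numIn_add_four_mul hF (U := L) (W := ⊤) (by omega) le_top K
    have h2 := Finset.sum_le_card_nsmul (pencil L ⊤) (fun X => numIn K X) 4 fun X hX => by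
      have hX3 : Module.finrank F X = 3 := by
        rw [finrank_of_mem_pencil (by omega) hX, hL]
      have := hK.numIn_le_five_of_tangent hF h3 (by omega) hX3 hL (mem_pencil.1 hX).1.le hL1
      have := h X hX
      show numIn K X ≤ 4
      omega
    rw [card_pencil hF (by omega) le_top, smul_eq_mul] at h2
    rw [numIn_top, hL1] at h1
    omega
  have hπ : Module.finrank F π = 3 := by rw [finrank_of_mem_pencil (by omega) hπL, hL]
  obtain ⟨N, hNπ, hN, hN0, htan⟩ := hK.exists_nucleus hF h3 (by omega) hπ hπ5
  -- the nucleus lies on no secant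
  have hnosec : ∀ S : Submodule F V, Module.finrank F S = 2 → N ≤ S → numIn K S ≤ 1 := by
    intro S hS hNS
    by_contra hlt
    have hS2 : numIn K S = 2 := by
      have := hK S hS
      omega
    have hSπ : ¬ S ≤ π := fun h => hlt (htan S h hS hNS).le
    have h1 := numIn_add_four_mul hF (U := S) (W := ⊤) (by omega) le_top K
    have h2 := Finset.sum_le_card_nsmul (pencil S ⊤) (fun X => numIn K X) 5 fun X hX => by
      have hX3 : Module.finrank F X = 3 := by
        rw [finrank_of_mem_pencil (by omega) hX, hS]
      have hSX := (mem_pencil.1 hX).1.le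
      have h4 := Submodule.finrank_sup_add_finrank_inf_eq X π
      have h5 := Submodule.finrank_le (X ⊔ π)
      have h6 : X ⊓ π < π := lt_of_le_of_ne inf_le_right fun h => hSπ (hSX.trans_eq
        (Submodule.eq_of_le_of_finrank_eq (inf_eq_right.1 h) (by omega)).symm)
      have h7 := Submodule.finrank_lt_finrank_of_lt h6
      have h8 : Module.finrank F (X ⊓ π : Submodule F V) = 2 := by omega
      exact hK.numIn_le_five_of_tangent hF h3 (by omega) hX3 h8 inf_le_left
        (htan _ inf_le_right h8 (le_inf (hNS.trans hSX) hNπ))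
    rw [card_pencil hF (by omega) le_top, smul_eq_mul] at h2
    rw [numIn_top, hS2] at h1
    omega
  obtain ⟨x, hxN, hx0⟩ := Submodule.exists_mem_ne_zero_of_ne_bot
    (show N ≠ ⊥ by rintro rfl; rw [finrank_bot] at hN; omega)
  have hxK : x ∉ K := fun h => by
    have := numIn_pos h hxN
    omega
  have hNx : N = Submodule.span F {x} := by
    symm
    apply Submodule.eq_of_le_of_finrank_eq ((Submodule.span_singleton_le_iff_mem _ _).2 hxN)
    rw [hN, finrank_span_singleton hx0]
  refine ⟨insert x K, fun S hS => ?_, by rw [Finset.card_insert_of_notMem hxK]; omega⟩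
  have hle : numIn (insert x K) S ≤ numIn K S + if x ∈ S then 1 else 0 := by
    unfold numIn
    rw [Finset.filter_insert]
    split_ifs with h
    · convert Finset.card_insert_le x (K.filter (· ∈ S))
    · exact le_of_eq (by congr)
  split_ifs at hle with hxS
  · have := hnosec S hS (hNx ▸ (Submodule.span_singleton_le_iff_mem _ _).2 hxS)
    omega
  · have := hK S hS
    omega

/-- A nonempty cap without tangent lines would have `22` points, while each of its plane sections
would be empty or a hyperoval with six points. -/
theorem IsCap.exists_tangent (hF : Fintype.card F = 4) (hK : IsCap F K) (h3 : 3 ≤ K.card)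
    (hV : Module.finrank F V = 4) :
    ∃ L : Submodule F V, Module.finrank F L = 2 ∧ numIn K L = 1 := by
  classical
  by_contra! hno
  have hV2 : 2 ≤ Module.finrank F V := by omega
  have htop : Module.finrank F (⊤ : Submodule F V) = 4 := by rw [finrank_top, hV]
  have hplane : ∀ π : Submodule F V, Module.finrank F π = 3 → 1 ≤ numIn K π →
      numIn K π = 6 := by
    intro π hπ h1
    obtain ⟨p, hp, hpπ⟩ := exists_of_numIn_pos h1
    have h2 := hK.sum_pencil_span_singleton hF h3 hV2 hp hpπ hπ
    rw [Finset.sum_congr rfl fun L hL => by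
      obtain ⟨hpL, -, hL2⟩ := (hK.mem_pencil_span_singleton h3 hV2 hp hπ).1 hL
      have h4 := numIn_pos hp hpL
      have h5 := hno L hL2
      have h6 := hK L hL2
      exact (show numIn K L = 2 by omega), Finset.sum_const,
      hK.card_pencil_span_singleton hF h3 hV2 hp hpπ hπ, smul_eq_mul] at h2
    omega
  obtain ⟨p, hp⟩ := Finset.card_pos.1 (show 0 < K.card by omega)
  have hp1 := finrank_span_singleton (K := F) (hK.ne_zero h3 hV2 hp)
  obtain ⟨S, hpS, -, hS⟩ := exists_submodule_finrank_eq (F := F) (U := Submodule.span F {p})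
    (W := ⊤) (m := 2) le_top (by omega) (by omega)
  rw [Submodule.span_singleton_le_iff_mem] at hpS
  have hS2 : numIn K S = 2 := by
    have := numIn_pos hp hpS
    have := hno S hS
    have := hK S hS
    omega
  have h22 : K.card = 22 := by
    have h1 := numIn_add_four_mul hF (U := S) (W := ⊤) (by omega) le_top K
    rw [Finset.sum_congr rfl fun X hX => hplane X
      (by rw [finrank_of_mem_pencil (by omega) hX, hS])
      ((numIn_pos hp hpS).trans (numIn_mono K (mem_pencil.1 hX).1.le)), Finset.sum_const,
      card_pencil hF (by omega) le_top, smul_eq_mul, numIn_top, hS2] at h1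
    omega
  -- a point off the cap on the secant `S`
  obtain ⟨Q, hQS, hQ0⟩ : ∃ Q ∈ pencil ⊥ S, numIn K Q = 0 := by
    by_contra! h
    have h1 := numIn_add_four_mul hF (U := ⊥) (W := S) (by rw [hS, finrank_bot]) bot_le K
    have h2 := Finset.card_nsmul_le_sum (pencil ⊥ S) (fun X => numIn K X) 1 fun X hX =>
      Nat.one_le_iff_ne_zero.2 (h X hX)
    have hbot : numIn K (⊥ : Submodule F V) = 0 := by
      rw [numIn, Finset.card_eq_zero, Finset.filter_eq_empty_iff]
      intro x hx h
      exact hK.ne_zero h3 hV2 hx ((Submodule.mem_bot F).1 h)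
    rw [card_pencil hF (by rw [hS, finrank_bot]) bot_le, smul_eq_mul] at h2
    omega
  have hQ : Module.finrank F Q = 1 := by
    rw [finrank_of_mem_pencil (by rw [hS, finrank_bot]) hQS, finrank_bot]
  obtain ⟨π, hSπ, -, hπ⟩ := exists_submodule_finrank_eq (F := F) (U := S)
    (W := ⊤) (m := 3) le_top (by omega) (by omega)
  have hQπ : Q ≤ π := (mem_pencil.1 hQS).2.le.trans hSπ
  -- a line without points of the cap
  obtain ⟨L, hL, hL0⟩ : ∃ L ∈ pencil Q π, numIn K L = 0 := by
    by_contra! h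
    have h1 := numIn_add_four_mul hF (U := Q) (W := π) (by omega) hQπ K
    rw [Finset.sum_congr rfl fun L hL => by
      have hL2 : Module.finrank F L = 2 := by rw [finrank_of_mem_pencil (by omega) hL, hQ]
      have h4 := h L hL
      have h5 := hno L hL2
      have h6 := hK L hL2
      exact (show numIn K L = 2 by omega), Finset.sum_const, card_pencil hF (by omega) hQπ,
      smul_eq_mul, hplane π hπ ((numIn_pos hp hpS).trans (numIn_mono K hSπ))] at h1
    omega
  have hL2 : Module.finrank F L = 2 := by rw [finrank_of_mem_pencil (by omega) hL, hQ]
  have h1 := numIn_add_four_mul hF (U := L) (W := ⊤) (by omega) le_top K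
  have h2 : 6 ∣ ∑ X ∈ pencil L ⊤, numIn K X := by
    apply Finset.dvd_sum
    intro X hX
    rcases Nat.eq_zero_or_pos (numIn K X) with h0 | h0
    · rw [h0]
      exact dvd_zero 6
    · rw [hplane X (by rw [finrank_of_mem_pencil (by omega) hX, hL2]) h0]
  rw [numIn_top, hL0] at h1
  omega

/-- A cap in the three-dimensional projective space over the field with four elements has at most
`17` points. -/
theorem IsCap.card_le (hF : Fintype.card F = 4) (hK : IsCap F K)
    (hV : Module.finrank F V = 4) : K.card ≤ 17 := by
  classical
  have : Fintype V := Fintype.ofFinite V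
  obtain ⟨M, hM, hmax⟩ := Finset.exists_max_image
    (Finset.univ.filter fun K : Finset V => IsCap F K) Finset.card ⟨K, by simpa using hK⟩
  rw [Finset.mem_filter] at hM
  have hKM := hmax K (by simpa using hK)
  by_contra hlt
  obtain ⟨L, hL, hL1⟩ := hM.2.exists_tangent hF (by omega) hV
  obtain ⟨K', hK', hlt'⟩ := hM.2.exists_larger hF (by omega) hV hL hL1
  have := hmax K' (by simpa using hK')
  omega

end CapBoundFinal

section NoLongCode

variable {F ι : Type*} [Field F] [Fintype F] [DecidableEq F] [Fintype ι] [DecidableEq ι]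

/-- The coordinates of a four-dimensional code of minimum distance `d ≥ 13` whose length exceeds `d`
by at most six would be a cap with more than `17` points in the dual space. -/
theorem lt_thirteen_of_finrank_eq_four (hF : Fintype.card F = 4) {V : Submodule F (ι → F)}
    {T : Finset ι} {d : ℕ} (hT : ∀ v ∈ V, ∀ i ∉ T, v i = 0) (hV : Module.finrank F V = 4)
    (hd : ∀ v ∈ V, v ≠ 0 → d ≤ hammingNorm v) (hcard : T.card ≤ d + 6) : d < 13 := by
  classical
  by_contra hlt
  let ev : ι → Module.Dual F V := fun i => (LinearMap.proj i : (ι → F) →ₗ[F] F).comp V.subtype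
  have : Finite (Module.Dual F V) := Module.finite_of_finite F
  have hdT : d ≤ T.card := by
    obtain ⟨v, hv, hv0⟩ := Submodule.exists_mem_ne_zero_of_ne_bot
      (show V ≠ ⊥ by rintro rfl; rw [finrank_bot] at hV; omega)
    refine (hd v hv hv0).trans (Finset.card_le_card fun i hi => ?_)
    by_contra hiT
    exact (Finset.mem_filter.1 hi).2 (hT v hv i hiT)
  have key : ∀ L : Submodule F (Module.Dual F V), Module.finrank F L ≤ 2 →
      5 * d + 4 * (T.filter fun i => ev i ∈ L).card ≤ 4 * T.card := by
    intro L hL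
    have h1 := Subspace.finrank_add_finrank_dualCoannihilator_eq L
    have h2 := five_mul_le_of_two_le_finrank hF (V := L.dualCoannihilator.map V.subtype)
      (T := T.filter fun i => ¬ ev i ∈ L) (d := d) ?_ ?_ ?_
    · have h4 := Finset.card_filter_add_card_filter_not (s := T) (fun i => ev i ∈ L)
      omega
    · rintro _ ⟨v, hv, rfl⟩ i hi
      by_cases hiT : i ∈ T
      · have hiL : ev i ∈ L := by
          by_contra h
          exact hi (Finset.mem_filter.2 ⟨hiT, h⟩)
        exact (Submodule.mem_dualCoannihilator v).1 hv _ hiL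
      · exact hT _ v.2 i hiT
    · rw [Submodule.finrank_map_subtype_eq]
      omega
    · rintro _ ⟨v, hv, rfl⟩ h0
      exact hd _ v.2 h0
  have hspan : ∀ i l, Module.finrank F
      (Submodule.span F ({ev i, ev l} : Set (Module.Dual F V))) ≤ 2 := by
    intro i l
    have := finrank_span_finset_le_card (R := F) ({ev i, ev l} : Finset (Module.Dual F V))
    rw [Finset.coe_pair] at this
    exact this.trans Finset.card_le_two
  have hinj : Set.InjOn ev T := by
    intro i hi j hj hij
    by_contra hne
    obtain ⟨l, hl, hlij⟩ : ∃ l ∈ T, l ∉ ({i, j} : Finset ι) := by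
      by_contra! h
      have := Finset.card_le_card (show T ⊆ {i, j} from h)
      have := Finset.card_le_two (a := i) (b := j)
      omega
    have h1 : ({i, j, l} : Finset ι) ⊆
        T.filter fun x => ev x ∈ Submodule.span F ({ev i, ev l} : Set (Module.Dual F V)) := by
      intro x hx
      rw [Finset.mem_insert, Finset.mem_insert, Finset.mem_singleton] at hx
      rw [Finset.mem_filter]
      rcases hx with rfl | rfl | rfl
      · exact ⟨hi, Submodule.subset_span (by simp)⟩
      · exact ⟨hj, Submodule.subset_span (by simp [hij])⟩
      · exact ⟨hl, Submodule.subset_span (by simp)⟩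
    have h2 := Finset.card_le_card h1
    have h5 : ({i, j, l} : Finset ι).card = 3 := by
      rw [Finset.mem_insert, Finset.mem_singleton, not_or] at hlij
      exact Finset.card_eq_three.2 ⟨i, j, l, hne, Ne.symm hlij.1, Ne.symm hlij.2, rfl⟩
    have := key _ (hspan i l)
    omega
  have hcap : IsCap F (T.image ev) := by
    intro L hL
    have h1 : numIn (T.image ev) L ≤ (T.filter fun i => ev i ∈ L).card := by
      unfold numIn
      rw [Finset.filter_image]
      exact Finset.card_image_le.trans (le_of_eq (by congr))
    have := key L hL.le
    omega
  have h17 := hcap.card_le hF (by rw [Subspace.dual_finrank_eq, hV])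
  rw [Finset.card_image_of_injOn hinj] at h17
  -- two coordinates already span a line, so `5 d + 8 ≤ 4 |T|`
  obtain ⟨i, hi, l, hl, hil⟩ := Finset.one_lt_card.1 (show 1 < T.card by omega)
  have h1 : ({i, l} : Finset ι) ⊆
      T.filter fun x => ev x ∈ Submodule.span F ({ev i, ev l} : Set (Module.Dual F V)) := by
    intro x hx
    rw [Finset.mem_insert, Finset.mem_singleton] at hx
    rw [Finset.mem_filter]
    rcases hx with rfl | rfl
    · exact ⟨hi, Submodule.subset_span (by simp)⟩
    · exact ⟨hl, Submodule.subset_span (by simp)⟩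
  have h2 := Finset.card_le_card h1
  rw [Finset.card_pair hil] at h2
  have := key _ (hspan i l)
  omega

end NoLongCode

/-! ### Repair groups of tight codes -/

section Projection

variable {F ι : Type*} [Field F] [DecidableEq ι]

/-- The projection that replaces the coordinates outside `S` by zero. It realizes the restriction
of words to `S` inside `ι → F`. -/
def projOn (F : Type*) {ι : Type*} [Field F] [DecidableEq ι] (S : Finset ι) :
    (ι → F) →ₗ[F] (ι → F) where
  toFun x i := if i ∈ S then x i else 0
  map_add' x y := by ext i; by_cases h : i ∈ S <;> simp [h]
  map_smul' a x := by ext i; by_cases h : i ∈ S <;> simp [h]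

theorem projOn_apply (S : Finset ι) (x : ι → F) (i : ι) :
    projOn F S x i = if i ∈ S then x i else 0 := rfl

theorem eq_zero_of_mem_map_projOn {C : Submodule F (ι → F)} {S : Finset ι} {x : ι → F}
    (hx : x ∈ C.map (projOn F S)) {i : ι} (hi : i ∉ S) : x i = 0 := by
  obtain ⟨c, -, rfl⟩ := hx
  simp [projOn_apply, hi]

theorem finrank_map_projOn [Fintype ι] (C : Submodule F (ι → F)) (S : Finset ι) :
    Module.finrank F (C.map (projOn F S)) + Module.finrank F (vanishingOn C S) =
      Module.finrank F C := by
  have h1 := LinearMap.finrank_range_add_finrank_ker ((projOn F S).domRestrict C)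
  have h2 : LinearMap.range ((projOn F S).domRestrict C) = C.map (projOn F S) :=
    LinearMap.range_domRestrict C _
  have h3 : (LinearMap.ker ((projOn F S).domRestrict C)).map C.subtype = vanishingOn C S := by
    ext x
    rw [mem_vanishingOn, Submodule.mem_map]
    constructor
    · rintro ⟨y, hy, rfl⟩
      refine ⟨y.2, fun i hi => ?_⟩
      have := congrFun (LinearMap.mem_ker.1 hy) i
      simpa [projOn_apply, hi] using this
    · rintro ⟨hx, h⟩
      refine ⟨⟨x, hx⟩, ?_, rfl⟩
      rw [LinearMap.mem_ker]
      ext i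
      by_cases hi : i ∈ S <;> simp [projOn_apply, hi, h]
  rw [← h3, Submodule.finrank_map_subtype_eq, ← h2]
  exact h1

variable [DecidableEq F] [Fintype ι]

theorem hammingNorm_projOn (S : Finset ι) (x : ι → F) :
    hammingNorm (projOn F S x) = (S.filter fun i => x i ≠ 0).card := by
  unfold hammingNorm
  congr 1
  ext i
  simp [projOn_apply]

omit [DecidableEq ι] in
theorem hammingNorm_le_card {T : Finset ι} {x : ι → F} (hx : ∀ i ∉ T, x i = 0) :
    hammingNorm x ≤ T.card :=
  Finset.card_le_card fun i hi => by
    by_contra hiT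
    exact (Finset.mem_filter.1 hi).2 (hx i hiT)

theorem IsRepairGroup.four_le_hammingNorm {C : Submodule F (ι → F)} {R : Finset ι}
    (hR : IsRepairGroup C R) {x : ι → F} (hx : x ∈ C.map (projOn F R)) (hx0 : x ≠ 0) :
    4 ≤ hammingNorm x := by
  obtain ⟨c, hc, rfl⟩ := hx
  rw [hammingNorm_projOn]
  obtain ⟨i, hi⟩ := Function.ne_iff.mp hx0
  rw [projOn_apply] at hi
  split_ifs at hi with hiR
  · exact hR.2 c hc ⟨i, hiR, hi⟩
  · exact absurd rfl hi

end Projection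

section Bounds

variable {F ι : Type*} [Field F] [DecidableEq F] [Fintype F] [Fintype ι] [DecidableEq ι]
  {C : Submodule F (ι → F)} {R S : Finset ι} {s d : ℕ}

namespace IsTight

theorem finrank_map_projOn_group (hC : IsTight C s d) (hF : Fintype.card F = 4) (hs : 1 ≤ s)
    {i : ι} (hi : i ∈ R) (hR : IsRepairGroup C R) :
    Module.finrank F (C.map (projOn F R)) = 3 := by
  have h1 := finrank_map_projOn C R
  have h2 := (hC.finrank_group hF hs hi hR).2
  have h3 := hC.finrank_eq
  omega

/-- The restriction of the code to a repair group is a `[6, 3, 4]` code. The words that vanish at one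
of the six coordinates form a `[5, 2, 4]` code, for which the Plotkin bound is attained, so that all
its nonzero words have weight four. -/
theorem card_filter_group_ne_five (hC : IsTight C s d) (hF : Fintype.card F = 4) (hs : 1 ≤ s)
    {i : ι} (hi : i ∈ R) (hR : IsRepairGroup C R) {c : ι → F} (hc : c ∈ C) :
    (R.filter fun i => c i ≠ 0).card ≠ 5 := by
  intro h5
  have h6 := (hC.finrank_group hF hs hi hR).1
  obtain ⟨p, hpR, hp⟩ : ∃ p ∈ R, c p = 0 := by
    by_contra! h
    rw [Finset.filter_true_of_mem h] at h5
    omega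
  have hx : projOn F R c ∈ C.map (projOn F R) ⊓
      LinearMap.ker (LinearMap.proj p : (ι → F) →ₗ[F] F) := by
    refine ⟨Submodule.mem_map_of_mem hc, ?_⟩
    simp [projOn_apply, hp]
  have hx0 : projOn F R c ≠ 0 := by
    intro h
    have := hammingNorm_projOn R c
    rw [h, hammingNorm_zero] at this
    omega
  have h1 := finrank_le_finrank_inf_ker (C.map (projOn F R))
    (LinearMap.proj p : (ι → F) →ₗ[F] F)
  rw [hC.finrank_map_projOn_group hF hs hi hR] at h1
  have h2 := hammingNorm_add_fourteen_mul_le hF (T := R.erase p) (d := 4)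
    (fun v hv j hj => by
      by_cases hjp : j = p
      · rw [hjp]
        exact hv.2
      · exact eq_zero_of_mem_map_projOn hv.1 fun hjR => hj (Finset.mem_erase.2 ⟨hjp, hjR⟩))
    (show 2 ≤ Module.finrank F (C.map (projOn F R) ⊓
      LinearMap.ker (LinearMap.proj p : (ι → F) →ₗ[F] F) : Submodule F (ι → F)) by omega)
    (fun v hv => hR.four_le_hammingNorm hv.1) hx hx0
  rw [hammingNorm_projOn, h5, Finset.card_erase_of_mem hpR, h6] at h2
  omega

/-- There is no code with parameters `[11, 4, 5]`: two repair groups cannot meet in one coordinate,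
because of the weights of a `[6, 3, 4]` code, and if they meet in two coordinates, there is no repair
group for the remaining coordinate. -/
theorem not_one_five (hF : Fintype.card F = 4) : ¬ IsTight C 1 5 := by
  intro hC
  have hn := hC.card_eq
  obtain ⟨i⟩ : Nonempty ι := Fintype.card_pos_iff.1 (by omega)
  obtain ⟨R, hi, hR⟩ := hC.cover i
  obtain ⟨hR6, hRz⟩ := hC.finrank_group hF le_rfl hi hR
  have hRc := Finset.card_compl_add_card R
  obtain ⟨j, hj⟩ := Finset.card_pos.1 (show 0 < Rᶜ.card by omega)
  rw [Finset.mem_compl] at hj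
  obtain ⟨R', hjR', hR'⟩ := hC.cover j
  obtain ⟨hR6', -⟩ := hC.finrank_group hF le_rfl hjR' hR'
  have h4 := hC.four_le_card_sdiff hF le_rfl hR hR' hi hjR' hj
  have h5 : (R' \ R).card ≤ Rᶜ.card := Finset.card_le_card fun x hx => by
    rw [Finset.mem_compl]
    exact (Finset.mem_sdiff.1 hx).2
  have hne5 : (R' \ R).card ≠ 5 := by
    obtain ⟨c, hc, hc0⟩ := Submodule.exists_mem_ne_zero_of_ne_bot
      (show vanishingOn C R ≠ ⊥ by intro h; rw [h, finrank_bot] at hRz; omega)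
    rw [mem_vanishingOn] at hc
    have h1 : (Finset.univ.filter fun i => c i ≠ 0) ⊆ Rᶜ := by
      intro x hx
      rw [Finset.mem_compl]
      exact fun h => (Finset.mem_filter.1 hx).2 (hc.2 x h)
    have h2 : 5 ≤ (Finset.univ.filter fun i => c i ≠ 0).card := hC.le_hammingNorm c hc.1 hc0
    have h3 := Finset.eq_of_subset_of_card_le h1 (by omega)
    have h6 : (R'.filter fun i => c i ≠ 0) = R' \ R := by
      ext x
      have : c x ≠ 0 ↔ x ∉ R := by
        rw [← Finset.mem_compl, ← h3]
        simp
      rw [Finset.mem_filter, Finset.mem_sdiff, this]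
    rw [← h6]
    exact hC.card_filter_group_ne_five hF le_rfl hjR' hR' hc.1
  have hU := Finset.card_sdiff_add_card R' R
  have hUc := Finset.card_compl_add_card (R' ∪ R)
  obtain ⟨q, hq⟩ := Finset.card_pos.1 (show 0 < (R' ∪ R)ᶜ.card by omega)
  rw [Finset.mem_compl, Finset.mem_union, not_or] at hq
  obtain ⟨R'', hqR'', hR''⟩ := hC.cover q
  obtain ⟨hR6'', -⟩ := hC.finrank_group hF le_rfl hqR'' hR''
  have h6 := hC.four_le_card_sdiff hF le_rfl hR hR'' hi hqR'' hq.2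
  have h7 := hC.four_le_card_sdiff hF le_rfl hR' hR'' hjR' hqR'' hq.1
  have h8 := Finset.card_sdiff_add_card_inter R'' R
  have h9 := Finset.card_sdiff_add_card_inter R'' R'
  have h10 : R'' ⊆ (R'' ∩ R) ∪ (R'' ∩ R') ∪ (R' ∪ R)ᶜ := by
    intro x hx
    by_cases h1 : x ∈ R <;> by_cases h2 : x ∈ R' <;> simp [hx, h1, h2]
  have h11 := Finset.card_le_card h10
  have h12 := Finset.card_union_le ((R'' ∩ R) ∪ (R'' ∩ R')) (R' ∪ R)ᶜ
  have h13 := Finset.card_union_le (R'' ∩ R) (R'' ∩ R')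
  omega

/-- For `s ≥ 2` the repair groups partition the coordinates. -/
theorem exists_partition (hC : IsTight C s d) (hF : Fintype.card F = 4) (hs : 2 ≤ s) :
    ∃ P : Finset (Finset ι), (∀ R ∈ P, IsRepairGroup C R ∧ R.Nonempty) ∧
      (∀ R ∈ P, ∀ R' ∈ P, R ≠ R' → Disjoint R R') ∧ (∀ i, ∃ R ∈ P, i ∈ R) ∧
      Fintype.card ι = 6 * P.card := by
  choose R hR using hC.cover
  have hdisj : ∀ A ∈ Finset.univ.image R, ∀ B ∈ Finset.univ.image R, A ≠ B → Disjoint A B := by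
    intro A hA B hB hAB
    obtain ⟨i, -, rfl⟩ := Finset.mem_image.1 hA
    obtain ⟨j, -, rfl⟩ := Finset.mem_image.1 hB
    exact hC.disjoint_groups hF hs (hR i).2 (hR j).2 (hR i).1 hAB
  refine ⟨Finset.univ.image R, ?_, hdisj, ?_, ?_⟩
  · intro A hA
    obtain ⟨i, -, rfl⟩ := Finset.mem_image.1 hA
    exact ⟨(hR i).2, i, (hR i).1⟩
  · exact fun i => ⟨R i, Finset.mem_image_of_mem R (Finset.mem_univ i), (hR i).1⟩
  · have h1 : (Finset.univ : Finset ι) = (Finset.univ.image R).biUnion id := by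
      symm
      rw [Finset.eq_univ_iff_forall]
      intro i
      rw [Finset.mem_biUnion]
      exact ⟨R i, Finset.mem_image_of_mem R (Finset.mem_univ i), (hR i).1⟩
    have h2 := Finset.card_biUnion (s := Finset.univ.image R) (t := id)
      fun A hA B hB hAB => hdisj A hA B hB hAB
    have h3 : ∀ A ∈ Finset.univ.image R, (id A).card = 6 := by
      intro A hA
      obtain ⟨i, -, rfl⟩ := Finset.mem_image.1 hA
      exact (hC.finrank_group hF (by omega) (hR i).1 (hR i).2).1
    rw [← h1, Finset.card_univ, Finset.sum_congr rfl h3, Finset.sum_const, smul_eq_mul] at h2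
    omega

theorem lt_thirteen (hC : IsTight C s d) (hF : Fintype.card F = 4) (hs : 1 ≤ s) : d < 13 := by
  obtain ⟨S, h1, h2⟩ := hC.exists_four_dim hs
  exact lt_thirteen_of_finrank_eq_four hF (T := Sᶜ)
    (fun v hv i hi => (mem_vanishingOn.1 hv).2 i (by simpa using hi)) h1
    (fun v hv => hC.le_hammingNorm v (mem_vanishingOn.1 hv).1) h2

end IsTight
end Bounds

/-! ### At most twenty repair groups for minimum distance twelve -/

section TwentyGroups

variable {F ι : Type*} [Field F] [DecidableEq F] [Fintype ι] [DecidableEq ι]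

theorem hammingNorm_sub_le (x y : ι → F) :
    hammingNorm (x - y) ≤ hammingNorm x + hammingNorm y := by
  refine le_trans (Finset.card_le_card fun i hi => ?_) (Finset.card_union_le _ _)
  simp only [Finset.mem_union, Finset.mem_filter, Finset.mem_univ, true_and] at hi ⊢
  by_contra! h
  exact hi (by simp [h.1, h.2])

variable [Fintype F] {C : Submodule F (ι → F)} {s : ℕ} {R R' : Finset ι}

open Classical in
/-- The nonzero words supported on `R` that agree on `R` with a codeword. -/
noncomputable def groupWords (C : Submodule F (ι → F)) (R : Finset ι) : Finset (ι → F) :=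
  Finset.univ.filter fun x => x ∈ C.map (projOn F R) ∧ x ≠ 0

theorem mem_groupWords {x : ι → F} :
    x ∈ groupWords C R ↔ x ∈ C.map (projOn F R) ∧ x ≠ 0 := by
  simp [groupWords]

theorem card_groupWords (hF : Fintype.card F = 4)
    (hR : Module.finrank F (C.map (projOn F R)) = 3) : (groupWords C R).card = 63 := by
  classical
  have h1 : Fintype.card (C.map (projOn F R)) = 64 := by
    rw [Module.card_eq_pow_finrank (K := F) (V := C.map (projOn F R)), hF, hR]; norm_num
  have h2 : groupWords C R = (Finset.univ.filter fun x => x ∈ C.map (projOn F R)).erase 0 := by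
    ext x
    simp [groupWords, and_comm]
  rw [h2, Finset.card_erase_of_mem
    (Finset.mem_filter.2 ⟨Finset.mem_univ _, Submodule.zero_mem _⟩), ← Fintype.card_subtype]
  exact congrArg (· - 1) h1

theorem sum_hammingNorm_groupWords (hF : Fintype.card F = 4) (h6 : R.card = 6)
    (hR : Module.finrank F (C.map (projOn F R)) = 3) :
    ∑ x ∈ groupWords C R, hammingNorm x ≤ 288 := by
  classical
  have h1 := four_mul_sum_hammingNorm_le hF (C.map (projOn F R)) R
    fun v hv i hi => eq_zero_of_mem_map_projOn hv hi
  have h2 : ∑ x ∈ groupWords C R, hammingNorm x ≤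
      ∑ v : C.map (projOn F R), hammingNorm v.1 := by
    rw [← Finset.sum_subtype (Finset.univ.filter fun x => x ∈ C.map (projOn F R))
      (fun x => by simp) (fun x : ι → F => hammingNorm x)]
    apply Finset.sum_le_sum_of_subset
    intro x hx
    simpa using (mem_groupWords.1 hx).1
  rw [hR, h6] at h1
  omega

theorem hammingNorm_le_of_mem_groupWords {x : ι → F} (hx : x ∈ groupWords C R) :
    hammingNorm x ≤ R.card :=
  hammingNorm_le_card fun _ hi => eq_zero_of_mem_map_projOn (mem_groupWords.1 hx).1 hi

omit [DecidableEq F] [Fintype ι] [Fintype F] in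
theorem eq_zero_of_sub_eq {x y : ι → F} (hRR' : Disjoint R R')
    (hx : ∀ i ∉ R, x i = 0) (hy : ∀ i ∉ R', y i = 0) (h : x = y) : x = 0 := by
  ext i
  by_cases hi : i ∈ R
  · rw [h]
    exact hy i (Finset.disjoint_left.1 hRR' hi)
  · exact hx i hi

/-- Modulo the code, words of two repair groups coincide in at most three pairs: in such a pair both
words have weight six, so a pair is determined by one of its coordinates. -/
theorem card_pairs_le (hF : Fintype.card F = 4) (hmin : ∀ c ∈ C, c ≠ 0 → 12 ≤ hammingNorm c)
    (h6 : R.card = 6) (h6' : R'.card = 6) (hRR' : Disjoint R R') [DecidablePred (· ∈ C)] :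
    ((groupWords C R ×ˢ groupWords C R').filter fun z => z.1 - z.2 ∈ C).card ≤ 3 := by
  obtain ⟨p, hp⟩ := Finset.card_pos.1 (show 0 < R.card by omega)
  have hcard : ((Finset.univ : Finset F).erase 0).card = 3 := by
    rw [Finset.card_erase_of_mem (Finset.mem_univ 0), Finset.card_univ, hF]
  rw [← hcard]
  apply Finset.card_le_card_of_injOn fun z => z.1 p
  · intro z hz
    rw [Finset.mem_coe, Finset.mem_filter, Finset.mem_product] at hz
    obtain ⟨⟨hx, hy⟩, hxy⟩ := hz
    rw [Finset.mem_coe, Finset.mem_erase]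
    refine ⟨fun h0 => ?_, Finset.mem_univ _⟩
    have h1 : hammingNorm z.1 ≤ (R.erase p).card := hammingNorm_le_card fun i hi => by
      by_cases hip : i = p
      · rw [hip]
        exact h0
      · exact eq_zero_of_mem_map_projOn (mem_groupWords.1 hx).1 fun hiR =>
          hi (Finset.mem_erase.2 ⟨hip, hiR⟩)
    rw [Finset.card_erase_of_mem hp] at h1
    have h2 := hammingNorm_le_of_mem_groupWords hy
    have h3 := hammingNorm_sub_le z.1 z.2
    by_cases h4 : z.1 - z.2 = 0
    · exact (mem_groupWords.1 hx).2 (eq_zero_of_sub_eq hRR'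
        (fun _ hi => eq_zero_of_mem_map_projOn (mem_groupWords.1 hx).1 hi)
        (fun _ hi => eq_zero_of_mem_map_projOn (mem_groupWords.1 hy).1 hi) (sub_eq_zero.1 h4))
    · have := hmin _ hxy h4
      omega
  · intro z hz w hw hzw
    rw [Finset.mem_coe, Finset.mem_filter, Finset.mem_product] at hz hw
    obtain ⟨⟨hx, hy⟩, hxy⟩ := hz
    obtain ⟨⟨hx', hy'⟩, hxy'⟩ := hw
    rw [mem_groupWords] at hx hy hx' hy'
    have hX := Submodule.sub_mem _ hx.1 hx'.1
    have hY := Submodule.sub_mem _ hy.1 hy'.1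
    have h1 : hammingNorm (z.1 - w.1) ≤ (R.erase p).card := hammingNorm_le_card fun i hi => by
      by_cases hip : i = p
      · rw [hip, Pi.sub_apply]
        exact sub_eq_zero.2 hzw
      · exact eq_zero_of_mem_map_projOn hX fun hiR => hi (Finset.mem_erase.2 ⟨hip, hiR⟩)
    rw [Finset.card_erase_of_mem hp] at h1
    have h2 : hammingNorm (z.2 - w.2) ≤ R'.card :=
      hammingNorm_le_card fun i hi => eq_zero_of_mem_map_projOn hY hi
    have h3 := hammingNorm_sub_le (z.1 - w.1) (z.2 - w.2)
    have h5 : (z.1 - w.1) - (z.2 - w.2) ∈ C := by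
      have := C.sub_mem hxy hxy'
      rwa [show (z.1 - z.2) - (w.1 - w.2) = (z.1 - w.1) - (z.2 - w.2) by abel] at this
    have h4 : (z.1 - w.1) - (z.2 - w.2) = 0 := by
      by_contra h4
      have := hmin _ h5 h4
      omega
    have h7 := eq_zero_of_sub_eq hRR' (fun _ hi => eq_zero_of_mem_map_projOn hX hi)
      (fun _ hi => eq_zero_of_mem_map_projOn hY hi) (sub_eq_zero.1 h4)
    have h8 : z.2 - w.2 = 0 := (sub_eq_zero.1 h4).symm.trans h7
    exact Prod.ext (sub_eq_zero.1 h7) (sub_eq_zero.1 h8)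

omit [DecidableEq F] in
/-- The words that agree on each of the `l` repair groups with a codeword form a space of dimension
at most `3 l`; modulo the code at most `4 ^ 5` classes remain. -/
theorem exists_classes (hF : Fintype.card F = 4) {P : Finset (Finset ι)}
    (hP3 : ∀ R ∈ P, Module.finrank F (C.map (projOn F R)) = 3)
    (hdisj : ∀ R ∈ P, ∀ R' ∈ P, R ≠ R' → Disjoint R R') (hcov : ∀ i, ∃ R ∈ P, i ∈ R)
    (hk : Module.finrank F C + 5 = 3 * P.card) :
    ∃ Y : Finset ((ι → F) ⧸ C), Y.card ≤ 1023 ∧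
      ∀ R ∈ P, ∀ x ∈ C.map (projOn F R), C.mkQ x ≠ 0 → C.mkQ x ∈ Y := by
  classical
  set D : Submodule F (ι → F) := P.sup fun R => C.map (projOn F R) with hD
  have hCD : C ≤ D := by
    intro c hc
    have h1 : c = ∑ R ∈ P, projOn F R c := by
      ext i
      obtain ⟨R, hR, hiR⟩ := hcov i
      rw [Finset.sum_apply, Finset.sum_eq_single_of_mem R hR]
      · rw [projOn_apply, if_pos hiR]
      · intro R' hR' hne
        rw [projOn_apply, if_neg]
        exact Finset.disjoint_left.1 (hdisj R hR R' hR' hne.symm) hiR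
    rw [h1]
    exact D.sum_mem fun R hR => (Finset.le_sup (f := fun R => C.map (projOn F R)) hR :)
      (Submodule.mem_map_of_mem hc)
  have hDr : Module.finrank F D ≤ 3 * P.card := by
    have key : ∀ P' ⊆ P, Module.finrank F
        (P'.sup fun R => C.map (projOn F R) : Submodule F (ι → F)) ≤ 3 * P'.card := by
      intro P' hP'
      induction P' using Finset.induction_on with
      | empty => rw [Finset.sup_empty, finrank_bot]; exact Nat.zero_le _
      | insert R P' hR ih =>
        rw [Finset.sup_insert, Finset.card_insert_of_notMem hR]
        have h1 := Submodule.finrank_add_le_finrank_add_finrank (C.map (projOn F R))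
          (P'.sup fun R => C.map (projOn F R))
        have h2 := hP3 R (hP' (Finset.mem_insert_self R P'))
        have h3 := ih ((Finset.subset_insert R P').trans hP')
        omega
    exact key P subset_rfl
  have hrank : Module.finrank F (D.map C.mkQ) ≤ 5 := by
    have h1 := LinearMap.finrank_range_add_finrank_ker (C.mkQ.domRestrict D)
    have h2 : LinearMap.range (C.mkQ.domRestrict D) = D.map C.mkQ :=
      LinearMap.range_domRestrict D _
    have h3 : (LinearMap.ker (C.mkQ.domRestrict D)).map D.subtype = C := by
      ext x
      rw [Submodule.mem_map]
      constructor
      · rintro ⟨y, hy, rfl⟩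
        exact (Submodule.Quotient.mk_eq_zero C).1 hy
      · intro hx
        exact ⟨⟨x, hCD hx⟩, (Submodule.Quotient.mk_eq_zero C).2 hx, rfl⟩
    have h4 : Module.finrank F (LinearMap.ker (C.mkQ.domRestrict D)) = Module.finrank F C := by
      rw [← Submodule.finrank_map_subtype_eq, h3]
    rw [h2] at h1
    omega
  have hfin : Finite ((ι → F) ⧸ C) := inferInstance
  have : Fintype ((ι → F) ⧸ C) := Fintype.ofFinite _
  refine ⟨(Finset.univ.filter fun y => y ∈ D.map C.mkQ).erase 0, ?_, ?_⟩
  · rw [Finset.card_erase_of_mem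
      (Finset.mem_filter.2 ⟨Finset.mem_univ _, Submodule.zero_mem _⟩), ← Fintype.card_subtype]
    have h1 : Fintype.card (D.map C.mkQ) ≤ 4 ^ 5 := by
      rw [Module.card_eq_pow_finrank (K := F) (V := D.map C.mkQ), hF]
      exact Nat.pow_le_pow_right (by norm_num) hrank
    have h2 : Fintype.card {y // y ∈ D.map C.mkQ} ≤ 4 ^ 5 := by convert h1
    omega
  · intro R hR x hx h0
    rw [Finset.mem_erase, Finset.mem_filter]
    exact ⟨h0, Finset.mem_univ _, Submodule.mem_map_of_mem
      ((Finset.le_sup (f := fun R => C.map (projOn F R)) hR :) hx)⟩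

/-- A code with `d = 12` has at most twenty repair groups. Modulo the code, a word of a repair group
of weight less than six is alone in its class, and words of weight six of two groups coincide in at
most three pairs. As `20 ≥ 8 m - m (m - 1)` for all natural numbers `m`, with `21` groups there would
be more classes than the `1023` available ones. -/
theorem IsTight.card_partition_le (hF : Fintype.card F = 4) (hC : IsTight C s 12) (hs : 2 ≤ s)
    {P : Finset (Finset ι)} (hP : ∀ R ∈ P, IsRepairGroup C R ∧ R.Nonempty)
    (hdisj : ∀ R ∈ P, ∀ R' ∈ P, R ≠ R' → Disjoint R R') (hcov : ∀ i, ∃ R ∈ P, i ∈ R)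
    (hcard : Fintype.card ι = 6 * P.card) : P.card ≤ 20 := by
  classical
  by_contra hlt
  have hP3 : ∀ R ∈ P, Module.finrank F (C.map (projOn F R)) = 3 := fun R hR =>
    hC.finrank_map_projOn_group hF (by omega) (hP R hR).2.choose_spec (hP R hR).1
  have hP6 : ∀ R ∈ P, R.card = 6 := fun R hR =>
    (hC.finrank_group hF (by omega) (hP R hR).2.choose_spec (hP R hR).1).1
  have hk : Module.finrank F C + 5 = 3 * P.card := by
    have h1 := hC.finrank_eq
    have h2 := hC.card_eq
    omega
  obtain ⟨Y, hY, hqY⟩ := exists_classes hF hP3 hdisj hcov hk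
  have hq : ∀ x, C.mkQ x = 0 ↔ x ∈ C := fun x => Submodule.Quotient.mk_eq_zero C
  set q := C.mkQ
  have hmin := hC.le_hammingNorm
  obtain ⟨T, hTP, hT⟩ := Finset.exists_subset_card_eq (show 21 ≤ P.card by omega)
  set X := T.biUnion (groupWords C) with hX
  have hXdisj : Set.PairwiseDisjoint (T : Set (Finset ι)) (groupWords C) := by
    intro R hR R' hR' hne
    rw [Function.onFun, Finset.disjoint_left]
    intro x hx hx'
    rw [mem_groupWords] at hx hx'
    exact hx.2 (eq_zero_of_sub_eq (hdisj R (hTP hR) R' (hTP hR') hne)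
      (fun _ hi => eq_zero_of_mem_map_projOn hx.1 hi)
      (fun _ hi => eq_zero_of_mem_map_projOn hx'.1 hi) rfl)
  have hXcard : X.card = 1323 := by
    rw [hX, Finset.card_biUnion hXdisj,
      Finset.sum_congr rfl fun R hR => card_groupWords hF (hP3 R (hTP hR)), Finset.sum_const, hT,
      smul_eq_mul]
  have hXsum : ∑ x ∈ X, hammingNorm x ≤ 6048 := by
    rw [hX, Finset.sum_biUnion hXdisj]
    refine (Finset.sum_le_card_nsmul T _ 288 fun R hR =>
      sum_hammingNorm_groupWords hF (hP6 R (hTP hR)) (hP3 R (hTP hR))).trans ?_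
    rw [hT, smul_eq_mul]
  have hX6 : ∀ x ∈ X, hammingNorm x ≤ 6 := by
    intro x hx
    obtain ⟨R, hR, hxR⟩ := Finset.mem_biUnion.1 hx
    rw [← hP6 R (hTP hR)]
    exact hammingNorm_le_of_mem_groupWords hxR
  have hX4 : ∀ x ∈ X, 4 ≤ hammingNorm x := by
    intro x hx
    obtain ⟨R, hR, hxR⟩ := Finset.mem_biUnion.1 hx
    rw [mem_groupWords] at hxR
    exact (hP R (hTP hR)).1.four_le_hammingNorm hxR.1 hxR.2
  have hXY : ∀ x ∈ X, q x ∈ Y := by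
    intro x hx
    obtain ⟨R, hR, hxR⟩ := Finset.mem_biUnion.1 hx
    have hxR' := mem_groupWords.1 hxR
    refine hqY R (hTP hR) x hxR'.1 fun h0 => ?_
    have h1 := hmin x ((hq x).1 h0) hxR'.2
    have h2 := hX6 x hx
    omega
  have hclass : ∀ x ∈ X, ∀ y ∈ X, x ≠ y → q x = q y → 12 ≤ hammingNorm x + hammingNorm y := by
    intro x _ y _ hne hxy
    refine le_trans (hmin _ ((hq _).1 ?_) (sub_ne_zero.2 hne)) (hammingNorm_sub_le x y)
    rw [map_sub, hxy, sub_self]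
  -- the weighted count of a single class
  have hfib : ∀ y ∈ Y, 44 * (X.filter fun x => q x = y).card ≤
      6 * (∑ x ∈ X.filter (fun x => q x = y), hammingNorm x) + 20 +
        (X.filter fun x => q x = y).offDiag.card := by
    intro y _
    set A := X.filter fun x => q x = y with hA
    have hAX : ∀ x ∈ A, x ∈ X ∧ q x = y := fun x hx => Finset.mem_filter.1 hx
    by_cases h : ∃ x ∈ A, hammingNorm x ≠ 6
    · obtain ⟨x, hxA, hx6⟩ := h
      have hsingle : A = {x} := by
        refine Finset.eq_singleton_iff_unique_mem.2 ⟨hxA, fun z hz => ?_⟩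
        by_contra hne
        have h1 := hclass z (hAX z hz).1 x (hAX x hxA).1 hne
          ((hAX z hz).2.trans (hAX x hxA).2.symm)
        have h2 := hX6 x (hAX x hxA).1
        have h3 := hX6 z (hAX z hz).1
        omega
      rw [hsingle, Finset.card_singleton, Finset.sum_singleton]
      have := hX4 x (hAX x hxA).1
      omega
    · push Not at h
      rw [Finset.sum_congr rfl h, Finset.sum_const, Finset.offDiag_card, smul_eq_mul]
      have h1 : A.card ≤ A.card * A.card := Nat.le_mul_self _
      zify [h1]
      have h2 : (0 : ℤ) ≤ ((A.card : ℤ) - 4) * ((A.card : ℤ) - 5) := by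
        rcases le_or_gt A.card 4 with h3 | h3
        · have : (A.card : ℤ) ≤ 4 := by exact_mod_cast h3
          nlinarith
        · have : (5 : ℤ) ≤ A.card := by exact_mod_cast h3
          nlinarith
      nlinarith
  have hpairs : ∑ y ∈ Y, (X.filter fun x => q x = y).offDiag.card ≤ 1260 := by
    have h1 : ∑ y ∈ Y, (X.filter fun x => q x = y).offDiag.card =
        (X.offDiag.filter fun z => q z.1 = q z.2).card := by
      rw [Finset.card_eq_sum_card_fiberwise (f := fun z => q z.1) (t := Y)]
      · apply Finset.sum_congr rfl
        intro y _
        congr 1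
        ext z
        simp only [Finset.mem_offDiag, Finset.mem_filter]
        constructor
        · rintro ⟨⟨h1, h2⟩, ⟨h3, h4⟩, h5⟩
          exact ⟨⟨⟨h1, h3, h5⟩, h2.trans h4.symm⟩, h2⟩
        · rintro ⟨⟨⟨h1, h3, h5⟩, h4⟩, h2⟩
          exact ⟨⟨h1, h2⟩, ⟨h3, h4 ▸ h2⟩, h5⟩
      · intro z hz
        exact hXY _ (Finset.mem_offDiag.1 (Finset.mem_filter.1 hz).1).1
    have h2 : (X.offDiag.filter fun z => q z.1 = q z.2) ⊆ T.offDiag.biUnion fun r =>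
        (groupWords C r.1 ×ˢ groupWords C r.2).filter fun z => z.1 - z.2 ∈ C := by
      intro z hz
      rw [Finset.mem_filter, Finset.mem_offDiag] at hz
      obtain ⟨⟨hz1, hz2, hne⟩, hqz⟩ := hz
      have hzC : z.1 - z.2 ∈ C := (hq _).1 (by rw [map_sub, hqz, sub_self])
      obtain ⟨R, hR, hzR⟩ := Finset.mem_biUnion.1 hz1
      obtain ⟨R', hR', hzR'⟩ := Finset.mem_biUnion.1 hz2
      rw [Finset.mem_biUnion]
      refine ⟨(R, R'), Finset.mem_offDiag.2 ⟨hR, hR', ?_⟩,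
        Finset.mem_filter.2 ⟨Finset.mem_product.2 ⟨hzR, hzR'⟩, hzC⟩⟩
      intro hRR'
      obtain rfl : R = R' := hRR'
      have h3 : hammingNorm (z.1 - z.2) ≤ R.card := hammingNorm_le_card fun i hi =>
        eq_zero_of_mem_map_projOn
          (Submodule.sub_mem _ (mem_groupWords.1 hzR).1 (mem_groupWords.1 hzR').1) hi
      have h4 := hmin _ hzC (sub_ne_zero.2 hne)
      have h5 := hP6 R (hTP hR)
      omega
    rw [h1]
    refine (Finset.card_le_card h2).trans ((Finset.card_biUnion_le_card_mul _ _ 3 ?_).trans ?_)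
    · intro r hr
      rw [Finset.mem_offDiag] at hr
      exact card_pairs_le hF hmin (hP6 _ (hTP hr.1)) (hP6 _ (hTP hr.2.1))
        (hdisj _ (hTP hr.1) _ (hTP hr.2.1) hr.2.2)
    · rw [Finset.offDiag_card, hT]
  have h1 := Finset.sum_le_sum hfib
  rw [Finset.sum_add_distrib, Finset.sum_add_distrib, ← Finset.mul_sum, ← Finset.mul_sum,
    ← Finset.card_eq_sum_card_fiberwise hXY, Finset.sum_fiberwise_of_maps_to hXY,
    Finset.sum_const, smul_eq_mul, hXcard] at h1
  omega

end TwentyGroups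

/-! ### Tight codes and optimal codes -/

section Optimal

variable {F ι : Type*} [Field F] [DecidableEq F] [Fintype F] [Fintype ι] [DecidableEq ι]
  {C : Submodule F (ι → F)} {s d : ℕ}

theorem ceil_div_three {s t : ℕ} (h1 : 1 ≤ t) (h3 : t ≤ 3) :
    ⌈((3 * s + t : ℕ) : ℚ) / ((3 : ℕ) : ℚ)⌉ = (s : ℤ) + 1 := by
  have h1' : (1 : ℚ) ≤ t := by exact_mod_cast h1
  have h3' : (t : ℚ) ≤ 3 := by exact_mod_cast h3
  rw [Int.ceil_eq_iff]
  push_cast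
  constructor
  · rw [lt_div_iff₀ (by norm_num)]
    linarith
  · rw [div_le_iff₀ (by norm_num)]
    linarith

/-- Writing `k = 3s + t` with `1 ≤ t ≤ 3`, the case `t ≠ 1` is excluded, and equality in the
Singleton-like bound becomes the condition `n = 6s + d` of a tight code. -/
theorem exists_isTight {n k : ℕ} (hF : Fintype.card F = 4) (hd : 5 ≤ d)
    (hC : IsOptimalLRC C n k d 3 4) :
    ∃ s, 1 ≤ s ∧ k = 3 * s + 1 ∧ n = 6 * s + d ∧ IsTight C s d := by
  obtain ⟨⟨hn, hk, hmin, -⟩, hlrc, -, hopt, -, -, -, hrk⟩ := hC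
  rw [minDistGE_iff] at hmin
  rw [isLRC_iff] at hlrc
  obtain ⟨s, t, ht1, ht3, hst⟩ : ∃ s t, 1 ≤ t ∧ t ≤ 3 ∧ k = 3 * s + t :=
    ⟨(k - 1) / 3, k - 3 * ((k - 1) / 3), by omega, by omega, by omega⟩
  rw [hst, ceil_div_three ht1 ht3] at hopt
  have hn' : n + 1 = 6 * s + d + t := by
    push_cast at hopt
    omega
  have ht : t = 1 := finrank_eq_of_length_eq hF hd hmin hlrc ht1 (hk.trans hst) (by omega)
  subst ht
  exact ⟨s, by omega, hst, by omega, hd, hmin, hlrc, hk.trans hst, by omega⟩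

/-- For the length `6 s + d` the dimension cannot exceed `3 s + 1`. -/
theorem isTight_of_le (hF : Fintype.card F = 4) (hd : 5 ≤ d)
    (hmin : ∀ c ∈ C, c ≠ 0 → d ≤ hammingNorm c)
    (hcov : ∀ i, ∃ R : Finset ι, i ∈ R ∧ IsRepairGroup C R)
    (hk : 3 * s + 1 ≤ Module.finrank F C) (hn : Fintype.card ι = 6 * s + d) :
    IsTight C s d := by
  refine ⟨hd, hmin, hcov, ?_, hn⟩
  by_contra hne
  obtain ⟨S, -, h1, h2⟩ := exists_chain_eq (C := C) hcov s 2 (by norm_num) ∅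
    (by rw [vanishingOn_empty]; omega)
  have := five_mul_le_of_two_le_finrank_vanishingOn hF hmin h1.ge
  rw [vanishingOn_empty, Finset.card_empty] at h2
  omega

/-- A code with the parameters of a tight code attains its minimum distance on the complement of `s`
repair groups, and all its repair groups have size six, so that its locality cannot be improved. -/
theorem IsTight.isOptimalLRC (hF : Fintype.card F = 4) (hs : 1 ≤ s) (hC : IsTight C s d) :
    IsOptimalLRC C (6 * s + d) (3 * s + 1) d 3 4 := by
  have hd := hC.five_le
  refine ⟨⟨hC.card_eq, hC.finrank_eq, minDistGE_iff.2 hC.le_hammingNorm, ?_⟩,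
    isLRC_iff.2 hC.cover, ?_, ?_, by norm_num, by omega, by norm_num, by omega⟩
  · have h0 : Module.finrank F (vanishingOn C ∅) = 3 * s + 1 := by
      rw [vanishingOn_empty, hC.finrank_eq]
    obtain ⟨S, -, h1, h2⟩ := exists_chain_eq hC.cover s 1 le_rfl ∅ (by omega)
    obtain ⟨c, hc, hc0⟩ := Submodule.exists_mem_ne_zero_of_ne_bot
      (show vanishingOn C S ≠ ⊥ by intro h; rw [h, finrank_bot] at h1; omega)
    rw [mem_vanishingOn] at hc
    have h3 := hammingNorm_le_card (T := Sᶜ) (x := c) fun i hi => hc.2 i (by simpa using hi)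
    have h4 := hC.le_hammingNorm c hc.1 hc0
    have h5 := Finset.card_compl_add_card S
    have h6 := hC.card_eq
    rw [Finset.card_empty] at h2
    refine ⟨c, hc.1, 0, C.zero_mem, hc0, ?_⟩
    rw [hammingDist_zero_right]
    omega
  · intro r' hr' hlrc
    have h1 := hC.card_eq
    obtain ⟨i⟩ : Nonempty ι := Fintype.card_pos_iff.1 (by omega)
    obtain ⟨R, hi, hR, hmin⟩ := hlrc i
    have h2 := hC.finrank_group hF hs hi ⟨by omega, minDistGE_restrictCode_iff.1 hmin⟩
    omega
  · rw [ceil_div_three le_rfl (by norm_num)]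
    push_cast
    ring

end Optimal

/-! ### Coding the field with four elements by numbers -/

section FourElements

/-- Multiplication of the field with four elements `0, 1, w, w ^ 2`, coded as `0, 1, 2, 3`. In this
code addition is the bitwise exclusive or. -/
def mulCode (a b : ℕ) : ℕ :=
  bif a == 0 || b == 0 then 0 else (a + b + 1) % 3 + 1

theorem mulCode_lt (a b : ℕ) : mulCode a b < 4 := by
  unfold mulCode
  cases (a == 0 || b == 0)
  · simp only [cond_false]
    omega
  · simp

theorem xor_lt_four {x y : ℕ} (hx : x < 4) (hy : y < 4) : x ^^^ y < 4 :=
  Nat.xor_lt_two_pow (n := 2) hx hy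

variable {F : Type*} [Field F] {w : F}

/-- The field element with the given code. -/
def ofCode (w : F) : ℕ → F
  | 0 => 0
  | 1 => 1
  | 2 => w
  | _ => w ^ 2

variable (hw : w ^ 2 = w + 1)

include hw in
theorem ofCode_eq_zero_iff {a : ℕ} (ha : a < 4) : ofCode w a = 0 ↔ a = 0 := by
  have h0 : w ≠ 0 := by
    rintro rfl
    simp at hw
  interval_cases a <;> simp [ofCode, h0]

variable [Fintype F] (hF : Fintype.card F = 4)

include hF in
theorem two_eq_zero : (2 : F) = 0 := by
  have h : ((Fintype.card F : ℕ) : F) = 0 := Nat.cast_card_eq_zero F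
  rw [hF] at h
  have h2 : (2 : F) * 2 = 0 := by
    rw [← h]
    norm_num
  exact mul_self_eq_zero.1 h2

include hF in
theorem ofCode_xor (hw : w ^ 2 = w + 1) {a b : ℕ} (ha : a < 4) (hb : b < 4) :
    ofCode w (a ^^^ b) = ofCode w a + ofCode w b := by
  have h2 := two_eq_zero hF
  interval_cases a <;> interval_cases b <;> simp [ofCode] <;> grind

include hF hw in
theorem ofCode_mulCode {a b : ℕ} (ha : a < 4) (hb : b < 4) :
    ofCode w (mulCode a b) = ofCode w a * ofCode w b := by
  have h2 := two_eq_zero hF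
  interval_cases a <;> interval_cases b <;> simp [ofCode, mulCode] <;> grind

include hF hw in
theorem ofCode_inj {a b : ℕ} (ha : a < 4) (hb : b < 4) (h : ofCode w a = ofCode w b) :
    a = b := by
  have h1 := ofCode_xor hF hw ha hb
  rw [h, ← two_mul, two_eq_zero hF, zero_mul, ofCode_eq_zero_iff hw (xor_lt_four ha hb)] at h1
  exact Nat.xor_eq_zero_iff.1 h1

include hF hw in
theorem exists_ofCode_eq (x : F) : ∃ a : Fin 4, ofCode w a = x := by
  have hinj : Function.Injective fun a : Fin 4 => ofCode w a :=
    fun a b h => Fin.ext (ofCode_inj hw hF a.isLt b.isLt h)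
  exact ((Fintype.bijective_iff_injective_and_card _).2 ⟨hinj, by rw [hF, Fintype.card_fin]⟩).2 x

end FourElements

/-! ### Explicit codes of dimension four -/

section DimensionFour

/-- The codes of the entries of `genMatrix18`. -/
def genCode : Fin 4 → Fin 18 → ℕ :=
  ![![0, 0, 0, 0, 0, 0, 1, 2, 1, 2, 1, 2, 3, 1, 3, 1, 3, 1],
    ![1, 0, 0, 1, 1, 1, 1, 0, 0, 1, 1, 1, 1, 0, 0, 1, 1, 1],
    ![0, 1, 0, 1, 3, 2, 0, 1, 0, 1, 3, 2, 0, 1, 0, 1, 3, 2],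
    ![0, 0, 1, 1, 2, 3, 0, 0, 1, 1, 2, 3, 0, 0, 1, 1, 2, 3]]

theorem genCode_lt : ∀ k j, genCode k j < 4 := by decide +kernel

/-- The code of the coordinate `j` of the codeword with message `a b c e`. -/
def wordCode (a b c e : ℕ) (j : Fin 18) : ℕ :=
  mulCode a (genCode 0 j) ^^^ mulCode b (genCode 1 j) ^^^ mulCode c (genCode 2 j) ^^^
    mulCode e (genCode 3 j)

/-- The number of nonzero coordinates in `A` of the codeword with message `a b c e`. -/
def weightOn (A : Finset (Fin 18)) (a b c e : Fin 4) : ℕ :=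
  (A.filter fun j => wordCode a b c e j ≠ 0).card

theorem wordCode_lt (a b c e : ℕ) (j : Fin 18) : wordCode a b c e j < 4 :=
  xor_lt_four (xor_lt_four (xor_lt_four (mulCode_lt _ _) (mulCode_lt _ _)) (mulCode_lt _ _))
    (mulCode_lt _ _)

variable {F : Type*} [Field F] {w : F}

theorem genMatrix18_apply (k : Fin 4) (j : Fin 18) :
    genMatrix18 w k j = ofCode w (genCode k j) := by
  fin_cases k <;> fin_cases j <;> rfl

variable [Fintype F]

theorem sum_mul_genMatrix18_eq (hF : Fintype.card F = 4) (hw : w ^ 2 = w + 1) (a : Fin 4 → Fin 4)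
    (j : Fin 18) :
    ∑ k, ofCode w (a k) * genMatrix18 w k j = ofCode w (wordCode (a 0) (a 1) (a 2) (a 3) j) := by
  have hm := mulCode_lt
  rw [Fin.sum_univ_four, wordCode, ofCode_xor hF hw (xor_lt_four (xor_lt_four (hm _ _) (hm _ _)) (hm _ _))
    (hm _ _), ofCode_xor hF hw (xor_lt_four (hm _ _) (hm _ _)) (hm _ _), ofCode_xor hF hw (hm _ _) (hm _ _)]
  simp only [genMatrix18_apply, ofCode_mulCode hw hF (a _).isLt (genCode_lt _ _)]

/-- The code generated by `genMatrix18`, restricted along an injection `g` whose range is the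
complement of `S`. The hypotheses on the weights concern all `256` messages and are checked by
evaluation. -/
theorem isTight_map_funLeft [DecidableEq F] {ι : Type*} [Fintype ι] [DecidableEq ι]
    (hF : Fintype.card F = 4) (hw : w ^ 2 = w + 1) (S : Finset (Fin 18)) {d : ℕ}
    {κ : Type*} (groups : κ → Finset (Fin 18)) (hd5 : 5 ≤ d)
    (hd : ∀ a b c e : Fin 4, (a = 0 ∧ b = 0 ∧ c = 0 ∧ e = 0) ∨
      d ≤ weightOn Sᶜ a b c e)
    (hsub : ∀ t, groups t ⊆ Sᶜ ∧ (groups t).card ≤ 6)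
    (hgroup : ∀ t, ∀ a b c e : Fin 4,
      weightOn (groups t) a b c e = 0 ∨ 4 ≤ weightOn (groups t) a b c e)
    (hcover : ∀ j ∈ Sᶜ, ∃ t, j ∈ groups t) (hn : (Sᶜ).card = 6 + d)
    (g : ι → Fin 18) (hg : Function.Injective g) (hgS : Finset.univ.image g = Sᶜ) :
    IsTight ((codeOfGenerator (genMatrix18 w)).map (LinearMap.funLeft F F g)) 1 d := by
  have hrange : codeOfGenerator (genMatrix18 w) =
      LinearMap.range (genMatrix18 w).vecMulLinear := by
    rw [codeOfGenerator, range_vecMulLinear]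
  have hgmem : ∀ i, g i ∈ Sᶜ := fun i => hgS ▸ Finset.mem_image_of_mem g (Finset.mem_univ i)
  have hcount : ∀ A ⊆ Sᶜ, ∀ p : Fin 18 → Prop, ∀ _ : DecidablePred p,
      (Finset.univ.filter fun i => g i ∈ A ∧ p (g i)).card = (A.filter p).card := by
    intro A hA p _
    rw [← Finset.card_image_of_injective _ hg]
    congr 1
    ext j
    simp only [Finset.mem_image, Finset.mem_filter, Finset.mem_univ, true_and]
    constructor
    · rintro ⟨i, h, rfl⟩
      exact h
    · intro h
      obtain ⟨i, -, rfl⟩ := Finset.mem_image.1 (hgS ▸ hA h.1)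
      exact ⟨i, h, rfl⟩
  have hword : ∀ m : Fin 4 → F, ∃ a b c e : Fin 4,
      (a = 0 ∧ b = 0 ∧ c = 0 ∧ e = 0 → m = 0) ∧
      ∀ j, (genMatrix18 w).vecMulLinear m j ≠ 0 ↔ wordCode a b c e j ≠ 0 := by
    intro m
    choose a ham using fun k => exists_ofCode_eq hw hF (m k)
    refine ⟨a 0, a 1, a 2, a 3, ?_, fun j => ?_⟩
    · rintro ⟨h0, h1, h2, h3⟩
      ext k
      rw [← ham k]
      fin_cases k <;> simp [h0, h1, h2, h3, ofCode]
    · have h1 : (genMatrix18 w).vecMulLinear m j = ofCode w (wordCode (a 0) (a 1) (a 2) (a 3) j) := by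
        rw [← sum_mul_genMatrix18_eq hF hw a]
        simp [Matrix.vecMul, dotProduct, ham]
      rw [h1, Ne, ofCode_eq_zero_iff hw (wordCode_lt _ _ _ _ _)]
  have hnorm : ∀ m : Fin 4 → F, m ≠ 0 →
      d ≤ hammingNorm (LinearMap.funLeft F F g ((genMatrix18 w).vecMulLinear m)) := by
    intro m hm
    obtain ⟨a, b, c, e, h0, hj⟩ := hword m
    rcases hd a b c e with h | h
    · exact absurd (h0 h) hm
    · refine h.trans (le_of_eq ?_)
      rw [weightOn, ← hcount _ subset_rfl, hammingNorm]
      congr 1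
      ext i
      simp only [Finset.mem_filter, Finset.mem_univ, true_and, LinearMap.funLeft_apply, hj]
      exact ⟨fun h => h.2, fun h => ⟨hgmem i, h⟩⟩
  apply isTight_of_le hF hd5
  · rintro _ ⟨x, hx, rfl⟩ h0
    rw [SetLike.mem_coe, hrange] at hx
    obtain ⟨m, rfl⟩ := hx
    apply hnorm
    rintro rfl
    exact h0 (by rw [map_zero, map_zero])
  · intro i
    obtain ⟨t, hiR⟩ := hcover (g i) (hgmem i)
    refine ⟨Finset.univ.filter fun i => g i ∈ groups t, by simpa using hiR, ?_, ?_⟩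
    · have := hcount _ (hsub t).1 (fun _ => True) inferInstance
      simp only [and_true, Finset.filter_true] at this
      rw [this]
      exact (hsub t).2
    · rintro _ ⟨x, hx, rfl⟩ ⟨i', hi', hne⟩
      rw [SetLike.mem_coe, hrange] at hx
      obtain ⟨m, rfl⟩ := hx
      obtain ⟨a, b, c, e, h0, hj⟩ := hword m
      have h1 : (Finset.filter (fun i => LinearMap.funLeft F F g
          ((genMatrix18 w).vecMulLinear m) i ≠ 0)
          (Finset.univ.filter fun i => g i ∈ groups t)).card = weightOn (groups t) a b c e := by
        rw [weightOn, ← hcount _ (hsub t).1, Finset.filter_filter]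
        congr 1
        ext i
        simp only [Finset.mem_filter, Finset.mem_univ, true_and, LinearMap.funLeft_apply, hj]
      have h2 : 0 < weightOn (groups t) a b c e := by
        rw [← h1]
        exact Finset.card_pos.2 ⟨i', Finset.mem_filter.2 ⟨hi', hne⟩⟩
      rw [h1]
      rcases hgroup t a b c e with h | h
      · omega
      · exact h
  · have hinj : Function.Injective
        ((LinearMap.funLeft F F g).comp (genMatrix18 w).vecMulLinear) := by
      rw [← LinearMap.ker_eq_bot, LinearMap.ker_eq_bot']
      intro m hm
      by_contra h
      have := hnorm m h
      rw [LinearMap.comp_apply] at hm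
      rw [hm, hammingNorm_zero] at this
      omega
    have h1 := LinearMap.finrank_range_of_inj hinj
    rw [LinearMap.range_comp, ← hrange, Module.finrank_fin_fun] at h1
    omega
  · rw [← Finset.card_univ, ← Finset.card_image_of_injective _ hg, hgS, hn]

/-- The coordinates that are deleted to obtain minimum distance `d`. -/
def deletedCoords : ℕ → Finset (Fin 18)
  | 12 => ∅
  | 11 => {17}
  | 10 => {9, 12}
  | 9 => {9, 12, 17}
  | 8 => {8, 9, 12, 17}
  | 7 => {9, 12, 13, 15, 17}
  | _ => {7, 9, 10, 12, 14, 17}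

/-- Repair groups that cover the remaining coordinates. Apart from the first six coordinates they
are hyperoval sections across the three blocks of the generator matrix. -/
def repairGroups : ℕ → Fin 4 → Finset (Fin 18)
  | 12 => ![{0, 1, 2, 3, 4, 5}, {1, 2, 6, 10, 15, 17}, {7, 9, 11, 12, 14, 16},
      {0, 3, 8, 10, 13, 17}]
  | 11 => ![{0, 1, 2, 3, 4, 5}, {7, 9, 11, 12, 14, 16}, {1, 5, 8, 9, 10, 12},
      {4, 5, 6, 8, 13, 15}]
  | 10 => ![{0, 1, 2, 3, 4, 5}, {0, 2, 11, 13, 15, 16}, {0, 3, 8, 10, 13, 17},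
      {3, 5, 6, 7, 10, 14}]
  | 9 => ![{0, 1, 2, 3, 4, 5}, {0, 2, 11, 13, 15, 16}, {1, 3, 6, 8, 11, 16},
      {3, 5, 6, 7, 10, 14}]
  | 8 => ![{0, 1, 2, 3, 4, 5}, {0, 2, 11, 13, 15, 16}, {3, 5, 6, 7, 10, 14},
      {0, 1, 2, 3, 4, 5}]
  | 7 => ![{0, 1, 2, 3, 4, 5}, {1, 3, 6, 8, 11, 16}, {3, 5, 6, 7, 10, 14},
      {0, 1, 2, 3, 4, 5}]
  | _ => ![{0, 1, 2, 3, 4, 5}, {0, 2, 11, 13, 15, 16}, {1, 3, 6, 8, 11, 16},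
      {0, 1, 2, 3, 4, 5}]

theorem card_compl_deletedCoords {d : ℕ} (h6 : 6 ≤ d) (h12 : d ≤ 12) :
    (deletedCoords d)ᶜ.card = 6 + d := by
  interval_cases d <;> decide +kernel

theorem le_weightOn_compl_deletedCoords {d : ℕ} (h6 : 6 ≤ d) (h12 : d ≤ 12) :
    ∀ a b c e : Fin 4, (a = 0 ∧ b = 0 ∧ c = 0 ∧ e = 0) ∨
      d ≤ weightOn (deletedCoords d)ᶜ a b c e := by
  interval_cases d <;> decide +kernel

theorem repairGroups_subset {d : ℕ} (h6 : 6 ≤ d) (h12 : d ≤ 12) :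
    ∀ t, repairGroups d t ⊆ (deletedCoords d)ᶜ ∧ (repairGroups d t).card ≤ 6 := by
  interval_cases d <;> decide +kernel

theorem weightOn_repairGroups {d : ℕ} (h6 : 6 ≤ d) (h12 : d ≤ 12) :
    ∀ t, ∀ a b c e : Fin 4, weightOn (repairGroups d t) a b c e = 0 ∨
      4 ≤ weightOn (repairGroups d t) a b c e := by
  interval_cases d <;> decide +kernel

theorem exists_mem_repairGroups {d : ℕ} (h6 : 6 ≤ d) (h12 : d ≤ 12) :
    ∀ j ∈ (deletedCoords d)ᶜ, ∃ t, j ∈ repairGroups d t := by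
  interval_cases d <;> decide +kernel

/-- The map `g` enumerates the coordinates that are kept, in any order. -/
theorem isOptimalLRC_map_funLeft [DecidableEq F] {ι : Type*} [Fintype ι]
    (hF : Fintype.card F = 4) (hw : w ^ 2 = w + 1) {d : ℕ} (h6 : 6 ≤ d) (h12 : d ≤ 12)
    (g : ι → Fin 18) (hg : Function.Injective g) (hgS : Set.range g = (deletedCoords d)ᶜ) :
    IsOptimalLRC ((codeOfGenerator (genMatrix18 w)).map (LinearMap.funLeft F F g)) (6 + d) 4 d
      3 4 := by
  classical
  exact (isTight_map_funLeft hF hw (deletedCoords d) (repairGroups d) (by omega)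
    (le_weightOn_compl_deletedCoords h6 h12) (repairGroups_subset h6 h12)
    (weightOn_repairGroups h6 h12) (exists_mem_repairGroups h6 h12)
    (card_compl_deletedCoords h6 h12) g hg
    (by rw [← Finset.coe_inj, Finset.coe_image, Finset.coe_univ, Set.image_univ, hgS, Finset.coe_compl])).isOptimalLRC
    hF le_rfl

theorem isOptimalLRC_punctureCode [DecidableEq F] (hF : Fintype.card F = 4)
    (hw : w ^ 2 = w + 1) {d : ℕ} (h6 : 6 ≤ d) (h12 : d ≤ 12) :
    IsOptimalLRC (punctureCode (codeOfGenerator (genMatrix18 w)) (deletedCoords d)) (6 + d) 4 d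
      3 4 :=
  isOptimalLRC_map_funLeft hF hw h6 h12 Subtype.val Subtype.val_injective (by ext; simp)

theorem exists_isOptimalLRC_four [DecidableEq F] (hF : Fintype.card F = 4)
    (hw : w ^ 2 = w + 1) {n d : ℕ} (h6 : 6 ≤ d) (h12 : d ≤ 12) (hn : n = d + 6) :
    ∃ C : Submodule F (Fin n → F), IsOptimalLRC C n 4 d 3 4 := by
  have hcard : (deletedCoords d)ᶜ.card = n := by
    rw [card_compl_deletedCoords h6 h12, hn, add_comm]
  have h := isOptimalLRC_map_funLeft hF hw h6 h12 ((deletedCoords d)ᶜ.orderEmbOfFin hcard)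
    (RelEmbedding.injective _) (by rw [Finset.range_orderEmbOfFin, Finset.coe_compl])
  rw [show 6 + d = n by omega] at h
  exact ⟨_, h⟩

end DimensionFour

/-! ### Codes given by local groups -/

section LocalGroups

/-- The codes of the word of the hexacode with the last three coordinates `a`, `b`, `c`. -/
def hexCode (a b c : ℕ) : Fin 6 → ℕ :=
  ![a ^^^ b ^^^ c, a ^^^ mulCode 2 b ^^^ mulCode 3 c, a ^^^ mulCode 3 b ^^^ mulCode 2 c, a, b, c]

theorem hexCode_lt (a b c : Fin 4) (k : Fin 6) : hexCode a b c k < 4 := by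
  revert a b c k
  decide +kernel

theorem four_le_card_hexCode (a b c : Fin 4) : (a = 0 ∧ b = 0 ∧ c = 0) ∨
    4 ≤ (Finset.univ.filter fun k => hexCode a b c k ≠ 0).card := by
  revert a b c
  decide +kernel

/-- The words of the hexacode in the kernel of `globalBlock6` have weight six. -/
theorem six_le_card_hexCode (a b c : Fin 4) (h1 : (a : ℕ) ^^^ mulCode 3 c = 0)
    (h2 : (b : ℕ) ^^^ mulCode 3 c = 0) : (a = 0 ∧ b = 0 ∧ c = 0) ∨
    6 ≤ (Finset.univ.filter fun k => hexCode a b c k ≠ 0).card := by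
  revert a b c
  decide +kernel

variable {F : Type*} [Field F] {w : F} [Fintype F] (hF : Fintype.card F = 4)
  (hw : w ^ 2 = w + 1)

include hF hw

theorem exists_hexCode_eq {y : Fin 6 → F} (hy : (hexacodeMatrix w).mulVec y = 0) :
    ∃ a b c : Fin 4, ∀ k, y k = ofCode w (hexCode a b c k) := by
  obtain ⟨a, ha⟩ := exists_ofCode_eq hw hF (y 3)
  obtain ⟨b, hb⟩ := exists_ofCode_eq hw hF (y 4)
  obtain ⟨c, hc⟩ := exists_ofCode_eq hw hF (y 5)
  have h2 := two_eq_zero hF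
  have e0 := congrFun hy 0
  have e1 := congrFun hy 1
  have e2 := congrFun hy 2
  simp [hexacodeMatrix, Matrix.mulVec, dotProduct, Fin.sum_univ_six] at e0 e1 e2
  refine ⟨a, b, c, fun k => ?_⟩
  have hm := mulCode_lt
  have h3 : ofCode w 3 = w ^ 2 := rfl
  have h4 : ofCode w 2 = w := rfl
  fin_cases k
  · show y 0 = ofCode w ((a : ℕ) ^^^ b ^^^ c)
    rw [ofCode_xor hF hw (xor_lt_four a.isLt b.isLt) c.isLt, ofCode_xor hF hw a.isLt b.isLt, ha,
      hb, hc]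
    linear_combination e0 - (y 3 + y 4 + y 5) * h2
  · show y 1 = ofCode w ((a : ℕ) ^^^ mulCode 2 b ^^^ mulCode 3 c)
    rw [ofCode_xor hF hw (xor_lt_four a.isLt (hm _ _)) (hm _ _),
      ofCode_xor hF hw a.isLt (hm _ _), ofCode_mulCode hw hF (by norm_num) b.isLt,
      ofCode_mulCode hw hF (by norm_num) c.isLt, ha, hb, hc, h3, h4]
    linear_combination e1 - (y 3 + w * y 4 + w ^ 2 * y 5) * h2
  · show y 2 = ofCode w ((a : ℕ) ^^^ mulCode 3 b ^^^ mulCode 2 c)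
    rw [ofCode_xor hF hw (xor_lt_four a.isLt (hm _ _)) (hm _ _),
      ofCode_xor hF hw a.isLt (hm _ _), ofCode_mulCode hw hF (by norm_num) b.isLt,
      ofCode_mulCode hw hF (by norm_num) c.isLt, ha, hb, hc, h3, h4]
    linear_combination e2 - (y 3 + w ^ 2 * y 4 + w * y 5) * h2
  · exact ha.symm
  · exact hb.symm
  · exact hc.symm

omit [Fintype F] hF in
theorem hammingNorm_eq_card_hexCode [DecidableEq F] {y : Fin 6 → F} {a b c : Fin 4}
    (h : ∀ k, y k = ofCode w (hexCode a b c k)) :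
    hammingNorm y = (Finset.univ.filter fun k => hexCode a b c k ≠ 0).card := by
  unfold hammingNorm
  congr 1
  ext k
  simp only [Finset.mem_filter, Finset.mem_univ, true_and, h k, Ne,
    ofCode_eq_zero_iff hw (hexCode_lt a b c k)]

omit [Fintype F] hF hw in
theorem eq_zero_of_hexCode {y : Fin 6 → F} {a b c : Fin 4}
    (h : ∀ k, y k = ofCode w (hexCode a b c k)) (h0 : a = 0 ∧ b = 0 ∧ c = 0) : y = 0 := by
  ext k
  rw [h k, h0.1, h0.2.1, h0.2.2]
  fin_cases k <;> rfl

theorem four_le_hammingNorm_of_hexacode [DecidableEq F] {y : Fin 6 → F}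
    (hy : (hexacodeMatrix w).mulVec y = 0) (hy0 : y ≠ 0) : 4 ≤ hammingNorm y := by
  obtain ⟨a, b, c, h⟩ := exists_hexCode_eq hF hw hy
  rcases four_le_card_hexCode a b c with h0 | h4
  · exact absurd (eq_zero_of_hexCode h h0) hy0
  · rwa [hammingNorm_eq_card_hexCode hw h]

omit [Fintype F] hF hw in
/-- The words are the families of hexacode words whose global syndromes cancel. -/
theorem mem_codeOfParityCheck_localGroupsMatrix {κ : Type*} [Fintype κ] [DecidableEq κ] {m : ℕ}
    {A : κ → Matrix (Fin m) (Fin 6) F} {x : κ × Fin 6 → F} :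
    x ∈ codeOfParityCheck (localGroupsMatrix w A) ↔
      (∀ i, (hexacodeMatrix w).mulVec (fun k => x (i, k)) = 0) ∧
        ∑ i, (A i).mulVec (fun k => x (i, k)) = 0 := by
  have h1 : ∀ i t, (localGroupsMatrix w A).mulVec x (Sum.inl (i, t)) =
      (hexacodeMatrix w).mulVec (fun k => x (i, k)) t := by
    intro i t
    simp [localGroupsMatrix, Matrix.mulVec, dotProduct, Fintype.sum_prod_type, Matrix.one_apply,
      Matrix.fromRows_apply_inl]
  have h2 : ∀ t, (localGroupsMatrix w A).mulVec x (Sum.inr t) =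
      (∑ i, (A i).mulVec (fun k => x (i, k))) t := by
    intro t
    simp [localGroupsMatrix, Matrix.mulVec, dotProduct, Fintype.sum_prod_type,
      Matrix.fromRows_apply_inr, Finset.sum_apply]
  rw [codeOfParityCheck, LinearMap.mem_ker, Matrix.mulVecLin_apply, funext_iff, Sum.forall]
  constructor
  · rintro ⟨h3, h4⟩
    exact ⟨fun i => funext fun t => (h1 i t).symm.trans (h3 (i, t)),
      funext fun t => (h2 t).symm.trans (h4 t)⟩
  · rintro ⟨h3, h4⟩
    exact ⟨fun p => (h1 p.1 p.2).trans (congrFun (h3 p.1) p.2),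
      fun t => (h2 t).trans (congrFun h4 t)⟩

/-- A code given by local groups is tight once its minimum distance is large enough: its dimension
is at least the number of coordinates minus the number of parity checks. -/
theorem isTight_localGroups [DecidableEq F] {κ : Type*} [Fintype κ] [DecidableEq κ] {m s d : ℕ}
    {A : κ → Matrix (Fin m) (Fin 6) F} (hd : 5 ≤ d)
    (hmin : ∀ x ∈ codeOfParityCheck (localGroupsMatrix w A), x ≠ 0 → d ≤ hammingNorm x)
    (hn : 6 * Fintype.card κ = 6 * s + d) (hk : 3 * s + 1 + m ≤ 3 * Fintype.card κ) :
    IsTight (codeOfParityCheck (localGroupsMatrix w A)) s d := by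
  apply isTight_of_le hF hd hmin
  · rintro ⟨i, k₀⟩
    refine ⟨Finset.univ.image fun k => (i, k), by simp, ?_, ?_⟩
    · exact Finset.card_image_le.trans (by simp)
    · rintro x hx ⟨p, hp, hxp⟩
      rw [mem_codeOfParityCheck_localGroupsMatrix] at hx
      obtain ⟨k, -, rfl⟩ := Finset.mem_image.1 hp
      refine (four_le_hammingNorm_of_hexacode hF hw (hx.1 i)
        fun h => hxp (congrFun h k)).trans (le_of_eq ?_)
      rw [Finset.filter_image, Finset.card_image_of_injective _ (Prod.mk_right_injective i)]
      rfl
  · have h1 := LinearMap.finrank_range_add_finrank_ker (localGroupsMatrix w A).mulVecLin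
    have h2 := Submodule.finrank_le (LinearMap.range (localGroupsMatrix w A).mulVecLin)
    rw [Module.finrank_fintype_fun_eq_card] at h1 h2
    simp only [Fintype.card_sum, Fintype.card_prod, Fintype.card_fin] at h1 h2
    rw [codeOfParityCheck]
    omega
  · simp only [Fintype.card_prod, Fintype.card_fin]
    omega

omit [Fintype F] hF hw in
theorem hammingNorm_eq_sum_blocks [DecidableEq F] {κ : Type*} [Fintype κ] (x : κ × Fin 6 → F) :
    hammingNorm x = ∑ i, hammingNorm fun k => x (i, k) := by
  simp only [hammingNorm, Finset.card_filter, Fintype.sum_prod_type]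

/-- Words of the code with at least three nonzero blocks have weight at least twelve, so only
words with one or two nonzero blocks have to be considered. -/
theorem le_hammingNorm_localGroups [DecidableEq F] {κ : Type*} [Fintype κ] [DecidableEq κ]
    {m d : ℕ} {A : κ → Matrix (Fin m) (Fin 6) F} (hd : d ≤ 12)
    (hone : ∀ i y, (hexacodeMatrix w).mulVec y = 0 → (A i).mulVec y = 0 → y ≠ 0 →
      d ≤ hammingNorm y)
    (htwo : ∀ i j, i ≠ j → ∀ y z, (hexacodeMatrix w).mulVec y = 0 →
      (hexacodeMatrix w).mulVec z = 0 → (A i).mulVec y + (A j).mulVec z = 0 → y ≠ 0 → z ≠ 0 →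
      d ≤ hammingNorm y + hammingNorm z) :
    ∀ x ∈ codeOfParityCheck (localGroupsMatrix w A), x ≠ 0 → d ≤ hammingNorm x := by
  intro x hx hx0
  rw [mem_codeOfParityCheck_localGroupsMatrix] at hx
  obtain ⟨hloc, hglob⟩ := hx
  set y : κ → Fin 6 → F := fun i k => x (i, k) with hy
  set B := Finset.univ.filter fun i => y i ≠ 0 with hB
  have hyB : ∀ i ∉ B, y i = 0 := by
    intro i hi
    by_contra h
    exact hi (Finset.mem_filter.2 ⟨Finset.mem_univ i, h⟩)
  have hBy : ∀ i ∈ B, y i ≠ 0 := fun i hi => (Finset.mem_filter.1 hi).2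
  have hnorm : hammingNorm x = ∑ i ∈ B, hammingNorm (y i) := by
    rw [hammingNorm_eq_sum_blocks]
    symm
    apply Finset.sum_subset (Finset.subset_univ B)
    intro i _ hi
    rw [hyB i hi, hammingNorm_zero]
  have hsum : ∑ i ∈ B, (A i).mulVec (y i) = 0 := by
    rw [← hglob]
    apply Finset.sum_subset (Finset.subset_univ B)
    intro i _ hi
    rw [hyB i hi, Matrix.mulVec_zero]
  rcases Nat.lt_or_ge B.card 3 with h3 | h3
  · have hcases : B.card = 0 ∨ B.card = 1 ∨ B.card = 2 := by omega
    rcases hcases with h | h | h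
    · rw [Finset.card_eq_zero] at h
      refine absurd (funext fun p => ?_) hx0
      exact congrFun (hyB p.1 (by rw [h]; exact Finset.notMem_empty _)) p.2
    · obtain ⟨i, hi⟩ := Finset.card_eq_one.1 h
      rw [hi, Finset.sum_singleton] at hsum hnorm
      rw [hnorm]
      exact hone i (y i) (hloc i) hsum (hBy i (by simp [hi]))
    · obtain ⟨i, j, hij, hi⟩ := Finset.card_eq_two.1 h
      rw [hi, Finset.sum_pair hij] at hsum hnorm
      rw [hnorm]
      exact htwo i j hij (y i) (y j) (hloc i) (hloc j) hsum (hBy i (by simp [hi]))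
        (hBy j (by simp [hi]))
  · have h1 := Finset.card_nsmul_le_sum B (fun i => hammingNorm (y i)) 4 fun i hi =>
      four_le_hammingNorm_of_hexacode hF hw (hloc i) (hBy i hi)
    rw [smul_eq_mul] at h1
    omega

theorem isTight_localGroups_globalBlock6 [DecidableEq F] {l : ℕ} (hl : 1 ≤ l) :
    IsTight (codeOfParityCheck (localGroupsMatrix w fun _ : Fin l => globalBlock6 w)) (l - 1) 6 := by
  apply isTight_localGroups hF hw (by norm_num)
  · apply le_hammingNorm_localGroups hF hw (by norm_num)
    · intro _ y hy hA hy0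
      obtain ⟨a, b, c, h⟩ := exists_hexCode_eq hF hw hy
      have key : ∀ a c : Fin 4, ofCode w a + w ^ 2 * ofCode w c = 0 →
          (a : ℕ) ^^^ mulCode 3 c = 0 := by
        intro a c hac
        rw [← ofCode_eq_zero_iff hw (xor_lt_four a.isLt (mulCode_lt _ _)),
          ofCode_xor hF hw a.isLt (mulCode_lt _ _), ofCode_mulCode hw hF (by norm_num) c.isLt]
        exact hac
      have e0 := congrFun hA 0
      have e1 := congrFun hA 1
      simp [globalBlock6, Matrix.mulVec, dotProduct, Fin.sum_univ_six, h] at e0 e1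
      rcases six_le_card_hexCode a b c (key a c e0) (key b c e1) with h0 | h6
      · exact absurd (eq_zero_of_hexCode h h0) hy0
      · rwa [hammingNorm_eq_card_hexCode hw h]
    · intro _ _ _ y z hy hz _ hy0 hz0
      have h1 := four_le_hammingNorm_of_hexacode hF hw hy hy0
      have h2 := four_le_hammingNorm_of_hexacode hF hw hz hz0
      omega
  · rw [Fintype.card_fin]
    omega
  · rw [Fintype.card_fin]
    omega

end LocalGroups

/-! ### Seventeen local groups for minimum distance twelve -/

section SeventeenGroups

/-- The codes of the coordinates of the vectors `uvz`. -/
def uvzCode : Fin 17 → Fin 3 → Fin 5 → ℕ :=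
  ![
    ![![3, 0, 2, 0, 0], ![0, 3, 3, 0, 0], ![3, 3, 0, 0, 0]],
    ![![3, 0, 0, 3, 2], ![0, 0, 0, 3, 1], ![3, 0, 0, 0, 1]],
    ![![0, 1, 2, 1, 2], ![1, 0, 1, 0, 1], ![0, 3, 2, 3, 2]],
    ![![0, 1, 2, 2, 3], ![1, 0, 1, 0, 2], ![3, 1, 0, 2, 0]],
    ![![0, 1, 2, 3, 1], ![1, 0, 1, 0, 3], ![2, 1, 1, 3, 3]],
    ![![1, 1, 1, 0, 2], ![1, 2, 1, 3, 3], ![1, 1, 2, 3, 2]],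
    ![![1, 1, 1, 1, 3], ![1, 2, 1, 1, 2], ![1, 1, 2, 2, 0]],
    ![![1, 1, 1, 2, 0], ![1, 2, 3, 2, 2], ![3, 2, 1, 0, 1]],
    ![![1, 1, 1, 3, 1], ![1, 2, 3, 0, 1], ![2, 1, 3, 1, 0]],
    ![![1, 1, 1, 0, 3], ![1, 1, 3, 3, 3], ![3, 2, 3, 2, 1]],
    ![![1, 1, 1, 1, 2], ![1, 3, 1, 0, 3], ![1, 1, 3, 2, 0]],
    ![![1, 1, 1, 2, 1], ![1, 2, 1, 2, 3], ![2, 2, 3, 1, 0]],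
    ![![1, 1, 1, 3, 0], ![1, 1, 2, 2, 2], ![1, 2, 1, 0, 2]],
    ![![1, 1, 1, 0, 1], ![1, 2, 3, 3, 2], ![3, 2, 1, 2, 2]],
    ![![1, 1, 1, 1, 0], ![1, 2, 3, 1, 1], ![2, 1, 3, 0, 2]],
    ![![1, 1, 1, 2, 3], ![1, 1, 3, 3, 0], ![3, 2, 3, 0, 3]],
    ![![1, 1, 1, 3, 2], ![1, 2, 3, 2, 0], ![2, 1, 3, 2, 3]]
  ]

theorem uvzCode_lt : ∀ i t n, uvzCode i t n < 4 := by decide +kernel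

/-- The code of the coordinate `n` of the image under `globalBlock12 w i` of the hexacode word with
the last three coordinates `a`, `b`, `c`. -/
def syndromeCode (i : Fin 17) (a b c : ℕ) (n : Fin 5) : ℕ :=
  mulCode a (uvzCode i 0 n) ^^^ mulCode b (uvzCode i 1 n) ^^^ mulCode c (uvzCode i 2 n)

/-- The five coordinates of `syndromeCode` as the digits of one number below `4 ^ 5`. -/
def syndrome (i : Fin 17) (p : ℕ × ℕ × ℕ) : ℕ :=
  syndromeCode i p.1 p.2.1 p.2.2 0 + 4 * (syndromeCode i p.1 p.2.1 p.2.2 1 +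
    4 * (syndromeCode i p.1 p.2.1 p.2.2 2 + 4 * (syndromeCode i p.1 p.2.1 p.2.2 3 +
      4 * syndromeCode i p.1 p.2.1 p.2.2 4)))

/-- The nonzero words of the hexacode, given by the codes of their last three coordinates. -/
def nonzeroWords : List (ℕ × ℕ × ℕ) :=
  ((List.range 4).product ((List.range 4).product (List.range 4))).filter
    fun p => p.1 != 0 || p.2.1 != 0 || p.2.2 != 0

/-- The nonzero words of the hexacode with a zero coordinate. -/
def lowWords : List (ℕ × ℕ × ℕ) :=
  nonzeroWords.filter fun p => decide (∃ k, hexCode p.1 p.2.1 p.2.2 k = 0)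

/-- The number whose binary digits are the characteristic function of the list. -/
def bitMask (l : List ℕ) : ℕ :=
  l.foldr (fun x m => (1 <<< x) ||| m) 0

theorem testBit_bitMask {l : List ℕ} {x : ℕ} (hx : x ∈ l) : (bitMask l).testBit x = true := by
  induction l with
  | nil => simp at hx
  | cons y l ih =>
    rw [bitMask, List.foldr_cons, Nat.testBit_or, Bool.or_eq_true]
    rcases List.mem_cons.1 hx with rfl | h
    · left
      simp [Nat.testBit_shiftLeft]
    · right
      exact ih h

theorem disjoint_of_bitMask {l l' : List ℕ} (h : bitMask l &&& bitMask l' = 0) {x : ℕ}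
    (hx : x ∈ l) (hx' : x ∈ l') : False := by
  have h1 := congrArg (fun m => m.testBit x) h
  simp [Nat.testBit_and, testBit_bitMask hx, testBit_bitMask hx'] at h1

theorem syndrome_zero (i : Fin 17) : syndrome i (0, 0, 0) = 0 := by
  simp [syndrome, syndromeCode, mulCode]

theorem syndrome_ne_zero : ∀ i, ∀ a b c : Fin 4, (a = 0 ∧ b = 0 ∧ c = 0) ∨
    syndrome i (a, b, c) ≠ 0 := by
  decide +kernel

/-- The images of the hexacode under two of the blocks meet in words of weight six only. -/
theorem bitMask_and_bitMask : ∀ i j, i = j ∨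
    bitMask (lowWords.map (syndrome i)) &&& bitMask (nonzeroWords.map (syndrome j)) = 0 := by
  decide +kernel

theorem mem_nonzeroWords {a b c : Fin 4} (h : ¬ (a = 0 ∧ b = 0 ∧ c = 0)) :
    ((a : ℕ), (b : ℕ), (c : ℕ)) ∈ nonzeroWords := by
  revert a b c
  decide +kernel

variable {F : Type*} [Field F] {w : F}

theorem uvz_apply (i : Fin 17) (t : Fin 3) (n : Fin 5) :
    uvz w i t n = ofCode w (uvzCode i t n) := by
  fin_cases i <;> fin_cases t <;> fin_cases n <;> rfl

theorem syndromeCode_lt (i : Fin 17) (a b c : ℕ) (n : Fin 5) : syndromeCode i a b c n < 4 :=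
  xor_lt_four (xor_lt_four (mulCode_lt _ _) (mulCode_lt _ _)) (mulCode_lt _ _)

variable [Fintype F] (hF : Fintype.card F = 4) (hw : w ^ 2 = w + 1)

include hF hw

theorem globalBlock12_mulVec_apply (i : Fin 17) {y : Fin 6 → F} {a b c : Fin 4}
    (h : ∀ k, y k = ofCode w (hexCode a b c k)) (n : Fin 5) :
    (globalBlock12 w i).mulVec y n = ofCode w (syndromeCode i a b c n) := by
  have e3 : y 3 = ofCode w a := h 3
  have e4 : y 4 = ofCode w b := h 4
  have e5 : y 5 = ofCode w c := h 5
  have hm := mulCode_lt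
  rw [syndromeCode, ofCode_xor hF hw (xor_lt_four (hm _ _) (hm _ _)) (hm _ _),
    ofCode_xor hF hw (hm _ _) (hm _ _), ofCode_mulCode hw hF a.isLt (uvzCode_lt _ _ _),
    ofCode_mulCode hw hF b.isLt (uvzCode_lt _ _ _), ofCode_mulCode hw hF c.isLt (uvzCode_lt _ _ _)]
  simp [globalBlock12, Matrix.mulVec, dotProduct, Fin.sum_univ_six, uvz_apply, e3, e4, e5, mul_comm]

/-- Equality of syndromes over `F` is equality of their encodings, which is decidable. -/
theorem syndrome_eq_of_mulVec_eq {i j : Fin 17} {y z : Fin 6 → F} {a b c a' b' c' : Fin 4}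
    (hy : ∀ k, y k = ofCode w (hexCode a b c k)) (hz : ∀ k, z k = ofCode w (hexCode a' b' c' k))
    (h : (globalBlock12 w i).mulVec y = (globalBlock12 w j).mulVec z) :
    syndrome i (a, b, c) = syndrome j (a', b', c') := by
  have key : ∀ n, syndromeCode i a b c n = syndromeCode j a' b' c' n := fun n =>
    ofCode_inj hw hF (syndromeCode_lt _ _ _ _ _) (syndromeCode_lt _ _ _ _ _) (by
      rw [← globalBlock12_mulVec_apply hF hw i hy, ← globalBlock12_mulVec_apply hF hw j hz, h])
  simp only [syndrome, key]

theorem eq_zero_of_globalBlock12 {i : Fin 17} {y : Fin 6 → F}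
    (hy : (hexacodeMatrix w).mulVec y = 0) (h : (globalBlock12 w i).mulVec y = 0) : y = 0 := by
  obtain ⟨a, b, c, hc⟩ := exists_hexCode_eq hF hw hy
  have h0 := syndrome_eq_of_mulVec_eq hF hw (i := i) (j := i) (z := 0) (a' := 0) (b' := 0)
    (c' := 0) hc (fun k => by fin_cases k <;> rfl) (by rw [h, Matrix.mulVec_zero])
  rcases syndrome_ne_zero i a b c with h1 | h1
  · exact eq_zero_of_hexCode hc h1
  · exact absurd (h0.trans (syndrome_zero i)) h1

/-- If the syndromes of two nonzero hexacode words in different blocks cancel, then the words have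
full weight; so a word supported on two blocks has weight twelve. -/
theorem six_le_hammingNorm_of_globalBlock12 [DecidableEq F] {i j : Fin 17} (hij : i ≠ j)
    {y z : Fin 6 → F} (hy : (hexacodeMatrix w).mulVec y = 0)
    (hz : (hexacodeMatrix w).mulVec z = 0)
    (h : (globalBlock12 w i).mulVec y + (globalBlock12 w j).mulVec z = 0) (hy0 : y ≠ 0)
    (hz0 : z ≠ 0) : 6 ≤ hammingNorm y := by
  obtain ⟨a, b, c, hc⟩ := exists_hexCode_eq hF hw hy
  obtain ⟨a', b', c', hc'⟩ := exists_hexCode_eq hF hw hz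
  have h2 := two_eq_zero hF
  have heq : (globalBlock12 w i).mulVec y = (globalBlock12 w j).mulVec z := by
    ext n
    have := congrFun h n
    rw [Pi.add_apply, Pi.zero_apply] at this
    linear_combination this - (globalBlock12 w j).mulVec z n * h2
  have hs := syndrome_eq_of_mulVec_eq hF hw hc hc' heq
  have hnz : ¬ (a = 0 ∧ b = 0 ∧ c = 0) := fun h0 => hy0 (eq_zero_of_hexCode hc h0)
  have hnz' : ¬ (a' = 0 ∧ b' = 0 ∧ c' = 0) := fun h0 => hz0 (eq_zero_of_hexCode hc' h0)
  have hall : ∀ k, hexCode a b c k ≠ 0 := by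
    by_contra! hex
    refine disjoint_of_bitMask ((bitMask_and_bitMask i j).resolve_left hij)
      (x := syndrome i (a, b, c)) (List.mem_map_of_mem ?_)
      (hs ▸ List.mem_map_of_mem (mem_nonzeroWords hnz'))
    exact List.mem_filter.2 ⟨mem_nonzeroWords hnz, decide_eq_true hex⟩
  rw [hammingNorm_eq_card_hexCode hw hc, Finset.filter_true_of_mem fun k _ => hall k]
  simp

theorem isTight_localGroups_globalBlock12 [DecidableEq F] (T : Finset (Fin 17))
    (hT : 3 ≤ T.card) :
    IsTight (codeOfParityCheck (localGroupsMatrix w fun i : {i // i ∈ T} => globalBlock12 w i.val))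
      (T.card - 2) 12 := by
  apply isTight_localGroups hF hw (by norm_num)
  · apply le_hammingNorm_localGroups hF hw le_rfl
    · intro i y hy h hy0
      exact absurd (eq_zero_of_globalBlock12 hF hw hy h) hy0
    · intro i j hij y z hy hz h hy0 hz0
      have hij' : i.val ≠ j.val := fun h => hij (Subtype.ext h)
      have h1 := six_le_hammingNorm_of_globalBlock12 hF hw hij' hy hz h hy0 hz0
      have h2 := six_le_hammingNorm_of_globalBlock12 hF hw hij'.symm hz hy
        (by rwa [add_comm] at h) hz0 hy0
      omega
  · rw [Fintype.card_coe]
    omega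
  · rw [Fintype.card_coe]
    omega

end SeventeenGroups

end LRCode

/-! ### The classification -/

theorem mainTheorem6 {F : Type*} [Field F] [DecidableEq F] (hF : Nat.card F = 4)
    (w : F) (hw : w ^ 2 = w + 1) :
    -- there is no optimal `[11, 4, 5]` code
    (¬ ∃ C : Submodule F (Fin 11 → F), IsOptimalLRC C 11 4 5 3 4) ∧
    -- the parameters of the optimal codes of dimension four
    (∀ n d : ℕ, 5 ≤ d →
      ((∃ C : Submodule F (Fin n → F), IsOptimalLRC C n 4 d 3 4) ↔
        n = d + 6 ∧ 6 ≤ d ∧ d ≤ 12)) ∧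
    -- there is no linear `[d + 6, 4, d]` code at all for `d ≥ 13`
    (∀ d : ℕ, 13 ≤ d → ¬ ∃ C : Submodule F (Fin (d + 6) → F), IsLinearCode C (d + 6) 4 d) ∧
    -- explicit codes of dimension four
    (IsOptimalLRC (codeOfGenerator (genMatrix18 w)) 18 4 12 3 4 ∧
      IsOptimalLRC (punctureCode (codeOfGenerator (genMatrix18 w)) {17}) 17 4 11 3 4 ∧
      IsOptimalLRC (punctureCode (codeOfGenerator (genMatrix18 w)) {9, 12}) 16 4 10 3 4 ∧
      IsOptimalLRC (punctureCode (codeOfGenerator (genMatrix18 w)) {9, 12, 17}) 15 4 9 3 4 ∧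
      IsOptimalLRC (punctureCode (codeOfGenerator (genMatrix18 w)) {8, 9, 12, 17}) 14 4 8 3 4 ∧
      IsOptimalLRC (punctureCode (codeOfGenerator (genMatrix18 w)) {9, 12, 13, 15, 17}) 13 4 7 3 4 ∧
      IsOptimalLRC (punctureCode (codeOfGenerator (genMatrix18 w)) {7, 9, 10, 12, 14, 17}) 12 4 6 3 4) ∧
    -- the parameters of all optimal codes
    (∀ (n k d : ℕ) (C : Submodule F (Fin n → F)), 5 ≤ d → IsOptimalLRC C n k d 3 4 →
      ∃ s : ℕ, 1 ≤ s ∧ k = 3 * s + 1 ∧ n = 6 * s + d ∧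
        (2 ≤ s → ∃ l : ℕ, n = 6 * l ∧
          ((d = 6 ∧ l = s + 1 ∧ k = 3 * l - 2 ∧ 3 ≤ l) ∨
            (d = 12 ∧ l = s + 2 ∧ k = 3 * l - 5 ∧ 4 ≤ l ∧ l ≤ 20)))) ∧
    -- explicit codes with `d = 6`
    (∀ l : ℕ, 3 ≤ l →
      IsOptimalLRC (codeOfParityCheck (localGroupsMatrix w fun _ : Fin l => globalBlock6 w))
        (6 * l) (3 * l - 2) 6 3 4) ∧
    -- the case `d = 12`, `l = 21` is impossible
    (¬ ∃ C : Submodule F (Fin (6 * 21) → F), IsOptimalLRC C (6 * 21) (3 * 21 - 5) 12 3 4) ∧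
    -- explicit codes with `d = 12`: any `l ≥ 4` of the seventeen groups
    (∀ T : Finset (Fin 17), 4 ≤ T.card →
      IsOptimalLRC
        (codeOfParityCheck (localGroupsMatrix w fun i : {i // i ∈ T} => globalBlock12 w i.val))
        (6 * T.card) (3 * T.card - 5) 12 3 4) := by
  classical
  have hfin : Finite F := Nat.finite_of_card_ne_zero (by rw [hF]; norm_num)
  have : Fintype F := Fintype.ofFinite F
  have hF' : Fintype.card F = 4 := by rw [← Nat.card_eq_fintype_card, hF]
  have hparams : ∀ (n k d : ℕ) (C : Submodule F (Fin n → F)), 5 ≤ d → IsOptimalLRC C n k d 3 4 →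
      ∃ s : ℕ, 1 ≤ s ∧ k = 3 * s + 1 ∧ n = 6 * s + d ∧
        (2 ≤ s → ∃ l : ℕ, n = 6 * l ∧
          ((d = 6 ∧ l = s + 1 ∧ k = 3 * l - 2 ∧ 3 ≤ l) ∨
            (d = 12 ∧ l = s + 2 ∧ k = 3 * l - 5 ∧ 4 ≤ l ∧ l ≤ 20))) := by
    intro n k d C hd hC
    obtain ⟨s, hs, hk, hn, hT⟩ := LRCode.exists_isTight hF' hd hC
    refine ⟨s, hs, hk, hn, fun hs2 => ?_⟩
    obtain ⟨P, hP, hdisj, hcov, hcard⟩ := hT.exists_partition hF' hs2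
    have h13 := hT.lt_thirteen hF' hs
    have hn' := hT.card_eq
    refine ⟨P.card, by omega, ?_⟩
    -- `d = 6 (l - s)` is a multiple of six between five and twelve
    have hd' : d = 6 ∨ d = 12 := by omega
    rcases hd' with rfl | rfl
    · left
      omega
    · right
      have := hT.card_partition_le hF' hs2 hP hdisj hcov hcard
      omega
  have hnone : ¬ ∃ C : Submodule F (Fin 11 → F), IsOptimalLRC C 11 4 5 3 4 := by
    rintro ⟨C, hC⟩
    obtain ⟨s, hs, hk, hn, hT⟩ := LRCode.exists_isTight hF' le_rfl hC
    obtain rfl : s = 1 := by omega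
    exact LRCode.IsTight.not_one_five hF' hT
  refine ⟨hnone, ?_, ?_, ⟨?_, ?_, ?_, ?_, ?_, ?_, ?_⟩, hparams, ?_, ?_, ?_⟩
  · intro n d hd
    constructor
    · rintro ⟨C, hC⟩
      obtain ⟨s, hs, hk, hn, hT⟩ := LRCode.exists_isTight hF' hd hC
      have h13 := hT.lt_thirteen hF' hs
      have hd5 : d ≠ 5 := by
        rintro rfl
        obtain rfl : n = 11 := by omega
        exact hnone ⟨C, hC⟩
      omega
    · rintro ⟨hn, h6, h12⟩
      exact LRCode.exists_isOptimalLRC_four hF' hw h6 h12 hn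
  · rintro d hd ⟨C, hC⟩
    have := LRCode.lt_thirteen_of_finrank_eq_four hF' (V := C) (T := Finset.univ) (d := d)
      (fun v _ i hi => absurd (Finset.mem_univ i) hi) hC.dim_eq
      (LRCode.minDistGE_iff.1 hC.minDist_ge) (by simp)
    omega
  · have h := LRCode.isOptimalLRC_map_funLeft hF' hw (d := 12) (by norm_num) le_rfl id
      Function.injective_id (by simp [LRCode.deletedCoords])
    rwa [show LinearMap.funLeft F F (id : Fin 18 → Fin 18) = LinearMap.id from rfl,
      Submodule.map_id] at h
  · exact LRCode.isOptimalLRC_punctureCode hF' hw (d := 11) (by norm_num) (by norm_num)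
  · exact LRCode.isOptimalLRC_punctureCode hF' hw (d := 10) (by norm_num) (by norm_num)
  · exact LRCode.isOptimalLRC_punctureCode hF' hw (d := 9) (by norm_num) (by norm_num)
  · exact LRCode.isOptimalLRC_punctureCode hF' hw (d := 8) (by norm_num) (by norm_num)
  · exact LRCode.isOptimalLRC_punctureCode hF' hw (d := 7) (by norm_num) (by norm_num)
  · exact LRCode.isOptimalLRC_punctureCode hF' hw (d := 6) (by norm_num) (by norm_num)
  · intro l hl
    have h := (LRCode.isTight_localGroups_globalBlock6 hF' hw (l := l) (by omega)).isOptimalLRC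
      hF' (by omega)
    rwa [show 6 * (l - 1) + 6 = 6 * l by omega, show 3 * (l - 1) + 1 = 3 * l - 2 by omega] at h
  · rintro ⟨C, hC⟩
    obtain ⟨s, hs, hk, hn, h⟩ := hparams _ _ _ C (by norm_num) hC
    obtain ⟨l, hl, h | h⟩ := h (by omega) <;> omega
  · intro T hT
    have h := (LRCode.isTight_localGroups_globalBlock12 hF' hw T (by omega)).isOptimalLRC
      hF' (by omega)
    rwa [show 6 * (T.card - 2) + 12 = 6 * T.card by omega,
      show 3 * (T.card - 2) + 1 = 3 * T.card - 5 by omega] at h
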